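/- **Setting.** For $N\in\mathbb N$, $N\ge 1$, write $x=(x_1,\dots,x_N)\in\mathbb R^{3N}$, $x_j\in\mathbb R^3$, let $\langle\langle\cdot,\cdot\rangle\rangle$ and $\|\cdot\|$ be the scalar product and norm of $L^2(\mathbb R^{3N},\mathbb C)$, and let $L^2_s(\mathbb R^{3N},\mathbb C)$ be the subspace of functions symmetric under permutations of $x_1,\dots,x_N$. For $V,A\in L^\infty(\mathbb R^3,\mathbb R)$ put $V_1(x)=N^2V(Nx)$ and $$H=-\sum_{j=1}^N\Delta_j+\sum_{1\le j<k\le N}V_1(x_j-x_k)+\sum_{j=1}^N A(x_j).$$ **Assumption on $V$.** Let $B_r(x)=\{z\in\mathbb R^3:|z-x|<r\}$. For $b_1,b_2>0$ divide $\mathbb R^3$ into the cubes of the cubic grid with side length $b_1/\sqrt3$, and let $n(b_1,b_2)$ be the maximal number (over $x\in\mathbb R^3$) of these cubes that meet $B_{b_2}(x)$. Let $V\in L^\infty(\mathbb R^3,\mathbb R)$ be spherically symmetric, with $V=V^+-V^-$, $V^\pm\ge0$ and $V^+V^-=0$. Assume that there are $R>r_2>0$, $r_1>0$, $\lambda^+>0$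 and $0<\epsilon<1$ such that, up to null sets, 1. $\{V^+\neq0\}=B_{r_2}(0)$ and $\{V^-\ne0\}=B_R(0)\setminus B_{r_2}(0)$; 2. $V^+\ge\lambda^+$ on $B_{r_1}(0)$; 3. with $\lambda^-=\|V^-\|_\infty$, $n_1=n(r_1,R)$, $n_2=n(r_1,3R)$, one has $\lambda^+>8n_2\lambda^-$, and $$\int_{B_R(0)}\Big(|\nabla\varphi|^2+\frac{n_1}{1-\epsilon}\,(2V^+-4V^-)\,|\varphi|^2\Big)d^3x\ \ge 0$$ for all $\varphi\in C^1(\mathbb R^3,\mathbb C)$ with $\varphi(x)=1$ for $|x|=R$. **Lemma.** Let $V$ satisfy this assumption and let $K\ge0$. There are constants $C_1,C_2>0$, depending only on $V$ and $K$, such that for every $A\in L^\infty(\mathbb R^3,\mathbb R)$ with $\|A\|_\infty\le K$, every $N\geq 1$ and every $\Psi\in L^2_s(\mathbb R^{3N},\mathbb C)\cap H^2(\mathbb R^{3N},\mathbb C)$ with $\|\Psi\|=1$: (a) if $N\ge3$, then $\ \|V_1(x_1-x_3)\Psi\|^2\le C_1\langle\langle\Psi,H\Psi\rangle\rangle+C_2N$;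 (b) $\ \|\nabla_1\Psi\|^2\le \dfrac{C_1}{N}\big(\langle\langle\Psi,H\Psi\rangle\rangle+C_2N\big)$. -/

import Mathlib

open MeasureTheory
open scoped ENNReal NNReal SchwartzMap LineDeriv Laplacian ComplexConjugate

/-- The physical space `ℝ³`. -/
abbrev E3 : Type := EuclideanSpace ℝ (Fin 3)

/-- The configuration space `ℝ^{3N}`; the coordinate `(j, a)` is the `a`-th component of `x_j`. -/
abbrev Config (N : ℕ) : Type := EuclideanSpace ℝ (Fin N × Fin 3)

/-- The position `x_j ∈ ℝ³` of the `j`-th particle. -/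
def pos {N : ℕ} (X : Config N) (j : Fin N) : E3 := WithLp.toLp 2 (fun a => X (j, a))

/-- The configuration with permuted particles, `(x_{σ 1}, …, x_{σ N})`. -/
def permute {N : ℕ} (σ : Equiv.Perm (Fin N)) (X : Config N) : Config N :=
  WithLp.toLp 2 (fun p => X (σ p.1, p.2))

/-! ### The class of interaction potentials -/

/-- The closed cube of side length `b / √3` with index `n ∈ ℤ³` in the standard division of `ℝ³`
into cubes. -/
def gridCube (b : ℝ) (n : Fin 3 → ℤ) : Set E3 :=
  {x | ∀ i, b / √3 * n i ≤ x i ∧ x i ≤ b / √3 * (n i + 1)}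

/-- `n(b₁, b₂)`: the maximal number of cubes of side length `b₁ / √3` that meet a ball of
radius `b₂`. -/
noncomputable def cubeNumber (b₁ b₂ : ℝ) : ℕ :=
  ⨆ x : E3, {n : Fin 3 → ℤ | (gridCube b₁ n ∩ Metric.ball x b₂).Nonempty}.ncard

/-- The index sets in `cubeNumber` are finite and their cardinalities are bounded, so that
`cubeNumber` is a genuine maximum. -/
theorem cubeNumber_wellDefined {b₁ : ℝ} (hb : 0 < b₁) (b₂ : ℝ) :
    (∀ x : E3, {n : Fin 3 → ℤ | (gridCube b₁ n ∩ Metric.ball x b₂).Nonempty}.Finite) ∧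
      BddAbove (Set.range fun x : E3 =>
        {n : Fin 3 → ℤ | (gridCube b₁ n ∩ Metric.ball x b₂).Nonempty}.ncard) := by
  have hs : 0 < b₁ / √3 := by positivity
  set s := b₁ / √3 with hsdef
  set m : ℤ := ⌈b₂ / s⌉ with hm
  have key : ∀ x : E3, {n : Fin 3 → ℤ | (gridCube b₁ n ∩ Metric.ball x b₂).Nonempty} ⊆
      ((Fintype.piFinset fun i => Finset.Icc (⌊x i / s⌋ - m - 1) (⌊x i / s⌋ + m + 1) :
        Finset (Fin 3 → ℤ)) : Set (Fin 3 → ℤ)) := by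
    rintro x n ⟨y, hy, hyx⟩
    rw [Finset.mem_coe, Fintype.mem_piFinset]
    intro i
    have h1 := hy i
    rw [← hsdef] at h1
    have h2 : |y i - x i| < b₂ := by
      have : ‖(y - x) i‖ ≤ ‖y - x‖ := PiLp.norm_apply_le (y - x) i
      rw [Metric.mem_ball, dist_eq_norm] at hyx
      have h3 : ‖(y - x) i‖ = |y i - x i| := by simp
      linarith
    obtain ⟨h2a, h2b⟩ := abs_lt.1 h2
    have hmb : b₂ ≤ m * s := by
      have := Int.le_ceil (b₂ / s)
      rwa [div_le_iff₀ hs] at this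
    have hf1 : (⌊x i / s⌋ : ℝ) * s ≤ x i := by
      have := Int.floor_le (x i / s)
      rwa [le_div_iff₀ hs] at this
    have hf2 : x i < ((⌊x i / s⌋ : ℝ) + 1) * s := by
      have := Int.lt_floor_add_one (x i / s)
      rwa [div_lt_iff₀ hs] at this
    rw [Finset.mem_Icc]
    constructor
    · have : (⌊x i / s⌋ : ℝ) - m < n i + 1 := by
        by_contra hc
        push Not at hc
        nlinarith [mul_le_mul_of_nonneg_left hc hs.le]
      have h : ⌊x i / s⌋ - m < n i + 1 := by exact_mod_cast this
      omega
    · have : (n i : ℝ) < ⌊x i / s⌋ + 1 + m := by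
        by_contra hc
        push Not at hc
        nlinarith [mul_le_mul_of_nonneg_left hc hs.le]
      have h : n i < ⌊x i / s⌋ + 1 + m := by exact_mod_cast this
      omega
  refine ⟨fun x => (Finset.finite_toSet _).subset (key x), ((2 * m + 3).toNat) ^ 3, ?_⟩
  rintro _ ⟨x, rfl⟩
  refine (Set.ncard_le_ncard (key x) (Finset.finite_toSet _)).trans ?_
  rw [Set.ncard_coe_finset, Fintype.card_piFinset]
  simp only [Int.card_Icc, Fin.prod_univ_three]
  have : ∀ i, ⌊x i / s⌋ + m + 1 + 1 - (⌊x i / s⌋ - m - 1) = 2 * m + 3 := fun i => by ring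
  simp only [this]
  exact le_of_eq (by ring)

/-- The positive part `V⁺`. Since `V = V⁺ - V⁻` with nonnegative `V⁺`, `V⁻` of disjoint supports,
`V⁺` and `V⁻` are determined by `V`. -/
def vPlus (V : E3 → ℝ) (x : E3) : ℝ := max (V x) 0

/-- The negative part `V⁻`. -/
def vMinus (V : E3 → ℝ) (x : E3) : ℝ := max (-V x) 0

/-- `|∇φ(x)|²` for a `C¹` function `φ : ℝ³ → ℂ`. -/
noncomputable def gradSq (φ : E3 → ℂ) (x : E3) : ℝ :=
  ∑ a : Fin 3, ‖fderiv ℝ φ x (EuclideanSpace.single a 1)‖ ^ 2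

/-- `∫_{B_R(0)} ( |∇φ|² + (1 - ε)⁻¹ n (2 V⁺ - 4 V⁻) |φ|² ) d³x`. -/
noncomputable def localEnergy (V : E3 → ℝ) (R ε : ℝ) (n : ℕ) (φ : E3 → ℂ) : ℝ :=
  ∫ x in Metric.ball (0 : E3) R,
    (gradSq φ x + 1 / (1 - ε) * n * (2 * vPlus V x - 4 * vMinus V x) * ‖φ x‖ ^ 2)

/-- The conditions on the interaction potential `V`, for given parameters `r₁, r₂, R, λ⁺`. As `V`
is an element of `L^∞`, pointwise conditions are understood almost everywhere, and the support is
the set of points where a function does not vanish, up to null sets. -/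
structure IsAdmissibleWith (V : E3 → ℝ) (r₁ r₂ R lamPlus : ℝ) : Prop where
  memLp_top : MemLp V ∞ volume
  spherical : ∃ v : ℝ → ℝ, Measurable v ∧ ∀ᵐ x : E3, V x = v ‖x‖
  r₂_pos : 0 < r₂
  r₂_lt_R : r₂ < R
  support_plus : Function.support (vPlus V) =ᵐ[volume] Metric.ball (0 : E3) r₂
  support_minus :
    Function.support (vMinus V) =ᵐ[volume] Metric.ball (0 : E3) R \ Metric.ball (0 : E3) r₂
  lamPlus_pos : 0 < lamPlus
  r₁_pos : 0 < r₁
  core : ∀ᵐ x : E3, x ∈ Metric.ball (0 : E3) r₁ → lamPlus ≤ vPlus V x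
  localEnergy_nonneg : ∃ ε : ℝ, 0 < ε ∧ ε < 1 ∧
    ∀ φ : E3 → ℂ, ContDiff ℝ 1 φ → (∀ x, ‖x‖ = R → φ x = 1) →
      0 ≤ localEnergy V R ε (cubeNumber r₁ R) φ
  lamPlus_gt :
    8 * (cubeNumber r₁ (3 * R) : ℝ) * (eLpNorm (vMinus V) ∞ volume).toReal < lamPlus

/-- The class of admissible interaction potentials. -/
def IsAdmissible (V : E3 → ℝ) : Prop :=
  ∃ r₁ r₂ R lamPlus : ℝ, IsAdmissibleWith V r₁ r₂ R lamPlus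

/-! ### Wave functions and the Hamiltonian -/

/-- The space `L²(ℝ^{3N}, ℂ)`. -/
abbrev WaveFn (N : ℕ) : Type := Lp ℂ 2 (volume : Measure (Config N))

/-- Membership in `H²(ℝ^{3N}, ℂ)`. -/
def MemH2 {N : ℕ} (Ψ : WaveFn N) : Prop :=
  TemperedDistribution.MemSobolev 2 2 (Ψ : 𝓢'(Config N, ℂ))

/-- Membership in `L²_s(ℝ^{3N}, ℂ)`: invariance under permutations of the particles. -/
def IsSymm {N : ℕ} (Ψ : WaveFn N) : Prop :=
  ∀ σ : Equiv.Perm (Fin N), (fun X => Ψ (permute σ X)) =ᵐ[volume] Ψ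

open Classical in
/-- The function in `L²` that represents a tempered distribution (`0` if there is none). -/
noncomputable def toL2 {N : ℕ} (T : 𝓢'(Config N, ℂ)) : WaveFn N :=
  if h : ∃ g : WaveFn N, T = (g : 𝓢'(Config N, ℂ)) then h.choose else 0

/-- The (distributional) Laplacian `∑_j Δ_j Ψ` on `ℝ^{3N}`, as an `L²` function for `Ψ ∈ H²`. -/
noncomputable def laplacianL2 {N : ℕ} (Ψ : WaveFn N) : WaveFn N :=
  toL2 (Δ (Ψ : 𝓢'(Config N, ℂ)))

/-- The (distributional) partial derivative of `Ψ` in the `a`-th component of `x_j`. -/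
noncomputable def partialL2 {N : ℕ} (j : Fin N) (a : Fin 3) (Ψ : WaveFn N) : WaveFn N :=
  toL2 (∂_{(EuclideanSpace.single (j, a) 1 : Config N)} (Ψ : 𝓢'(Config N, ℂ)))

theorem MemH2.laplacianL2_eq {N : ℕ} {Ψ : WaveFn N} (h : MemH2 Ψ) :
    Δ (Ψ : 𝓢'(Config N, ℂ)) = (laplacianL2 Ψ : 𝓢'(Config N, ℂ)) := by
  have h1 := TemperedDistribution.MemSobolev.laplacian h
  rw [sub_self, TemperedDistribution.memSobolev_zero_iff] at h1
  rw [laplacianL2, toL2, dif_pos h1]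
  exact h1.choose_spec

theorem MemH2.partialL2_eq {N : ℕ} {Ψ : WaveFn N} (h : MemH2 Ψ) (j : Fin N) (a : Fin 3) :
    ∂_{(EuclideanSpace.single (j, a) 1 : Config N)} (Ψ : 𝓢'(Config N, ℂ))
      = (partialL2 j a Ψ : 𝓢'(Config N, ℂ)) := by
  have h1 := TemperedDistribution.MemSobolev.lineDerivOp
    (m := (EuclideanSpace.single (j, a) 1 : Config N)) h
  have h2 := TemperedDistribution.MemSobolev.mono (s' := 0) (by norm_num) h1
  rw [TemperedDistribution.memSobolev_zero_iff] at h2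
  rw [partialL2, toL2, dif_pos h2]
  exact h2.choose_spec

/-- `‖∇_j Ψ‖²`. -/
noncomputable def gradNormSq {N : ℕ} (j : Fin N) (Ψ : WaveFn N) : ℝ :=
  ∑ a : Fin 3, ‖partialL2 j a Ψ‖ ^ 2

/-- The scaled potential `V₁(x) = N² V(N x)`. -/
def scaledPot (N : ℕ) (V : E3 → ℝ) (x : E3) : ℝ := (N : ℝ) ^ 2 * V ((N : ℝ) • x)

/-- `HΨ = -∑_j Δ_j Ψ + ∑_{j<k} V₁(x_j - x_k) Ψ + ∑_j A(x_j) Ψ`. -/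
noncomputable def hamiltonian {N : ℕ} (V A : E3 → ℝ) (Ψ : WaveFn N) (X : Config N) : ℂ :=
  -(laplacianL2 Ψ X)
    + ((∑ j : Fin N, ∑ k ∈ Finset.Ioi j, scaledPot N V (pos X j - pos X k) : ℝ) : ℂ) * Ψ X
    + ((∑ j : Fin N, A (pos X j) : ℝ) : ℂ) * Ψ X

/-- The (real) number `⟪Ψ, HΨ⟫`. -/
noncomputable def energyForm {N : ℕ} (V A : E3 → ℝ) (Ψ : WaveFn N) : ℝ :=
  (∫ X : Config N, conj (Ψ X) * hamiltonian V A Ψ X).re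

/-- `‖V₁(x_j - x_k) Ψ‖²`. -/
noncomputable def pairPotNormSq {N : ℕ} (V : E3 → ℝ) (j k : Fin N) (Ψ : WaveFn N) : ℝ :=
  ∫ X : Config N, ‖(scaledPot N V (pos X j - pos X k) : ℂ) * Ψ X‖ ^ 2

/-! Let `T`, `P` and `M` be the kinetic energy of `Ψ` and the expectations of the repulsive and
attractive parts of the interaction, summed over ordered pairs. The energy is `T + (P - M)/2`, up to
an external term of size at most `K N`. Everything follows from one form bound, `4 M ≤ T + (2 + 4κ)
P` with `κ = 4 n₁ λ⁻/λ⁺ < 1/2`. An eighth of it absorbs `M/2` and leaves `7/8 T + (1/4 - κ/2) P ≤ E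
+ K N`, so `T`, `P` and then `M` are bounded by multiples of `E + K N`. By symmetry `T` is `N` times
the energy of one particle, which gives (b). For (a), `V₁²` is at most a constant times `N² (V₁⁺ +
V₁⁻)`, and by symmetry the expectation of `V₁⁺ + V₁⁻` for one pair is `(P + M)/(N(N-1))`.

The form bound is geometric (`kineticSq_add_pair_nonneg`). Rescale the particles by `N` and sort
them into cubes of diameter `r₁`. A pair `(j, k)` is good if no third particle lies in the cube of
`k`, and bad otherwise.

Good pairs are handled by the one-body hypothesis. Goodness does not depend on `x_j`, so the local
form inequality around `x_k` can be applied in the variable `x_j` with all other particles fixed.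
The good partners of `j` occupy different cubes, hence at most `n₁` of them are within range and the
kinetic energy of `j` is used at most `n₁` times.

Bad pairs are handled by counting (`sum_badInd_le`). Those within range number at most `4 n₁` times
the ordered pairs that share a cube, and each of the latter has repulsion at least `λ⁺`. The
attraction of bad pairs is therefore at most `κ` times the total repulsion.

Two analytic points remain. The hypothesis concerns only functions equal to `1` on the sphere of
radius `R`; `localForm_nonneg` extends it to all `C¹` functions by passing to the normalised root of
the spherical average of `|ψ|²`, which does not increase the energy. The bound is proved for
Schwartz functions and carried to `H²` by density. -/

/-! ### Spherical averages -/

/-- The unit sphere of `ℝ³`. -/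
abbrev UnitSphere3 : Type := Metric.sphere (0 : E3) 1

/-- The rotation invariant probability measure on the unit sphere. -/
noncomputable def sphereProb : Measure UnitSphere3 :=
  ((volume : Measure E3).toSphere Set.univ)⁻¹ • (volume : Measure E3).toSphere

instance : IsProbabilityMeasure sphereProb := by
  refine ⟨?_⟩
  rw [sphereProb, Measure.smul_apply, smul_eq_mul]
  exact ENNReal.inv_mul_cancel
    (fun h => Measure.toSphere_ne_zero (volume : Measure E3) (Measure.measure_univ_eq_zero.1 h))
    (measure_ne_top _ _)

theorem toSphere_eq_smul_sphereProb :
    (volume : Measure E3).toSphere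
      = ((volume : Measure E3).toSphere Set.univ) • sphereProb := by
  rw [sphereProb, smul_smul, ENNReal.mul_inv_cancel
    (fun h => Measure.toSphere_ne_zero (volume : Measure E3) (Measure.measure_univ_eq_zero.1 h))
    (measure_ne_top _ _), one_smul]

/-- The average of `F` over the sphere of radius `r`. -/
noncomputable def sphereAvg (F : E3 → ℝ) (r : ℝ) : ℝ :=
  ∫ ω : UnitSphere3, F (r • (ω : E3)) ∂sphereProb

theorem integral_eq_polar {G : E3 → ℝ} (hG : Integrable G) :
    ∫ x, G x = ((volume : Measure E3).toSphere.real Set.univ) *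
      ∫ r : Set.Ioi (0 : ℝ), sphereAvg G r ∂Measure.volumeIoiPow 2 := by
  have hd : Module.finrank ℝ E3 - 1 = 2 := by simp
  have hmp := (volume : Measure E3).measurePreserving_homeomorphUnitSphereProd
  rw [hd] at hmp
  have hemb := (Homeomorph.measurableEmbedding (homeomorphUnitSphereProd E3))
  set H : UnitSphere3 × Set.Ioi (0 : ℝ) → ℝ := fun p => G ((p.2 : ℝ) • (p.1 : E3)) with hH
  have hHG : ∀ x : ({(0)}ᶜ : Set E3), H (homeomorphUnitSphereProd E3 x) = G x := by
    intro x
    have := (homeomorphUnitSphereProd E3).symm_apply_apply x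
    have h2 := congrArg Subtype.val this
    rw [homeomorphUnitSphereProd_symm_apply_coe] at h2
    simp only [hH, h2]
  have hint : Integrable H ((volume : Measure E3).toSphere.prod (.volumeIoiPow 2)) := by
    rw [← hmp.integrable_comp_emb hemb]
    have : H ∘ (homeomorphUnitSphereProd E3) = fun x : ({(0)}ᶜ : Set E3) => G x := funext hHG
    rw [this]
    have := (integrableOn_iff_comap_subtypeVal (f := G) (μ := volume)
      (measurableSet_singleton (0 : E3)).compl).1 hG.integrableOn
    exact this
  calc ∫ x, G x = ∫ x : ({(0)}ᶜ : Set E3), G x ∂((volume : Measure E3).comap Subtype.val) := by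
        rw [integral_subtype_comap (measurableSet_singleton _).compl G, restrict_compl_singleton]
    _ = ∫ p, H p ∂((volume : Measure E3).toSphere.prod (.volumeIoiPow 2)) := by
        rw [← hmp.integral_comp hemb]
        exact integral_congr_ae (Filter.Eventually.of_forall fun x => (hHG x).symm)
    _ = ∫ r : Set.Ioi (0 : ℝ), ∫ ω, H (ω, r) ∂(volume : Measure E3).toSphere
          ∂Measure.volumeIoiPow 2 := integral_prod_symm _ hint
    _ = _ := by
        rw [← integral_const_mul]
        refine integral_congr_ae (Filter.Eventually.of_forall fun r => ?_)
        simp only [hH, sphereAvg]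
        conv_lhs => rw [toSphere_eq_smul_sphereProb, integral_smul_measure]
        rfl

theorem sphereAvg_radial_mul (u : ℝ → ℝ) (F : E3 → ℝ) {r : ℝ} (hr : 0 ≤ r) :
    sphereAvg (fun x => u ‖x‖ * F x) r = u r * sphereAvg F r := by
  simp only [sphereAvg]
  rw [← integral_const_mul]
  refine integral_congr_ae (Filter.Eventually.of_forall fun ω => ?_)
  have : ‖r • (ω : E3)‖ = r := by
    rw [norm_smul, norm_eq_of_mem_sphere ω, mul_one, Real.norm_of_nonneg hr]
  simp only [this]

theorem sphereAvg_radial (g : ℝ → ℝ) {r : ℝ} (hr : 0 ≤ r) :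
    sphereAvg (fun x => g ‖x‖) r = g r := by
  have := sphereAvg_radial_mul g (fun _ => 1) hr
  simpa [sphereAvg] using this

/-- Integrals against radial weights only depend on spherical averages. -/
theorem integral_radial_mul_sphereAvg (u : ℝ → ℝ) (F : E3 → ℝ)
    (h1 : Integrable fun x : E3 => u ‖x‖ * F x)
    (h2 : Integrable fun x : E3 => u ‖x‖ * sphereAvg F ‖x‖) :
    ∫ x : E3, u ‖x‖ * F x = ∫ x : E3, u ‖x‖ * sphereAvg F ‖x‖ := by
  rw [integral_eq_polar h1, integral_eq_polar h2]
  congr 1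
  refine integral_congr_ae (Filter.Eventually.of_forall fun r => ?_)
  have hr : 0 ≤ (r : ℝ) := r.2.le
  simp only [sphereAvg_radial_mul u _ hr, sphereAvg_radial (sphereAvg F) hr]

theorem continuous_sphereAvg {F : E3 → ℝ} (hF : Continuous F) : Continuous (sphereAvg F) := by
  have := continuous_parametric_integral_of_continuous (μ := sphereProb)
    (f := fun (r : ℝ) (ω : UnitSphere3) => F (r • (ω : E3))) (by fun_prop) isCompact_univ
  simpa [sphereAvg] using! this

theorem integrable_sphereProb {F : UnitSphere3 → ℝ} (hF : Continuous F) :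
    Integrable F sphereProb := by
  have := hF.continuousOn.integrableOn_compact (μ := sphereProb) isCompact_univ
  simpa using this

theorem sphereAvg_hasDerivAt {F : E3 → ℝ} (hF : ContDiff ℝ 1 F) (r : ℝ) :
    HasDerivAt (sphereAvg F) (∫ ω : UnitSphere3, fderiv ℝ F (r • (ω : E3)) (ω : E3) ∂sphereProb) r := by
  have hc : Continuous F := hF.continuous
  have hc' : Continuous (fderiv ℝ F) := hF.continuous_fderiv one_ne_zero
  obtain ⟨M, hM⟩ := (isCompact_closedBall (0 : E3) (|r| + 1)).bddAbove_image
    (f := fun x => ‖fderiv ℝ F x‖) (by fun_prop)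
  refine (hasDerivAt_integral_of_dominated_loc_of_deriv_le (μ := sphereProb)
    (F := fun (r : ℝ) (ω : UnitSphere3) => F (r • (ω : E3)))
    (F' := fun r ω => fderiv ℝ F (r • (ω : E3)) (ω : E3)) (bound := fun _ => M)
    (Metric.ball_mem_nhds r one_pos) ?_ ?_ ?_ ?_ (integrable_const _) ?_).2
  · exact Filter.Eventually.of_forall fun t =>
      (integrable_sphereProb (by fun_prop)).aestronglyMeasurable
  · exact integrable_sphereProb (by fun_prop)
  · exact (integrable_sphereProb (by fun_prop)).aestronglyMeasurable
  · refine Filter.Eventually.of_forall fun ω t ht => ?_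
    have h1 : ‖(ω : E3)‖ = 1 := norm_eq_of_mem_sphere ω
    have ht' : |t - r| < 1 := by simpa [Real.dist_eq] using ht
    have h2 : t • (ω : E3) ∈ Metric.closedBall (0 : E3) (|r| + 1) := by
      rw [mem_closedBall_zero_iff, norm_smul, h1, mul_one, Real.norm_eq_abs]
      have := abs_sub_abs_le_abs_sub t r
      linarith
    calc _ ≤ ‖fderiv ℝ F (t • (ω : E3))‖ * ‖(ω : E3)‖ := ContinuousLinearMap.le_opNorm _ _
      _ ≤ M := by rw [h1, mul_one]; exact hM ⟨_, h2, rfl⟩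
  · refine Filter.Eventually.of_forall fun ω t _ => ?_
    have hd : HasFDerivAt F (fderiv ℝ F (t • (ω : E3))) (t • (ω : E3)) :=
      (hF.differentiable one_ne_zero _).hasFDerivAt
    have hl : HasDerivAt (fun t : ℝ => t • (ω : E3)) (ω : E3) t := by
      simpa using (hasDerivAt_id t).smul_const (ω : E3)
    exact hd.comp_hasDerivAt t hl

open scoped Pointwise in
theorem measurePreserving_neg_sphereProb :
    MeasurePreserving (fun ω : UnitSphere3 => -ω) sphereProb sphereProb := by
  have hm : Measurable (fun ω : UnitSphere3 => -ω) := continuous_neg.measurable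
  have h : MeasurePreserving (fun ω : UnitSphere3 => -ω)
      (volume : Measure E3).toSphere (volume : Measure E3).toSphere := by
    refine ⟨hm, Measure.ext fun s hs => ?_⟩
    rw [Measure.map_apply hm hs, Measure.toSphere_apply' _ (hm hs), Measure.toSphere_apply' _ hs]
    congr 1
    have : ((↑) '' ((fun ω : UnitSphere3 => -ω) ⁻¹' s) : Set E3) = -((↑) '' s : Set E3) := by
      ext x
      simp only [Set.mem_image, Set.mem_preimage, Set.mem_neg]
      constructor
      · rintro ⟨ω, hω, rfl⟩; exact ⟨-ω, hω, by simp⟩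
      · rintro ⟨ω, hω, h⟩; exact ⟨-ω, by simpa using hω, by simp [h]⟩
    rw [this]
    have h3 : Set.Ioo (0 : ℝ) 1 • (-((↑) '' s : Set E3)) = -(Set.Ioo (0 : ℝ) 1 • ((↑) '' s : Set E3)) := by
      ext x
      simp only [Set.mem_smul, Set.mem_neg]
      constructor
      · rintro ⟨r, hr, y, hy, rfl⟩; exact ⟨r, hr, -y, hy, smul_neg _ _⟩
      · rintro ⟨r, hr, y, hy, h⟩; exact ⟨r, hr, -y, by simpa using hy, by rw [smul_neg, h, neg_neg]⟩
    rw [h3, Measure.measure_neg]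
  exact h.smul_measure _

/-- The integrand is odd and the measure is invariant under the antipodal map. At radius `0` this
makes the derivative of a spherical average vanish, as required for radial functions to be `C¹` at
the origin. -/
theorem integral_clm_sphereProb (L : E3 →L[ℝ] ℝ) :
    ∫ ω : UnitSphere3, L (ω : E3) ∂sphereProb = 0 := by
  have h := measurePreserving_neg_sphereProb.integral_comp
    (Homeomorph.neg UnitSphere3).measurableEmbedding (fun ω : UnitSphere3 => L (ω : E3))
  simp only [Metric.sphere] at h
  have h2 : ∫ ω : UnitSphere3, L ((-ω : UnitSphere3) : E3) ∂sphereProb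
      = -∫ ω : UnitSphere3, L (ω : E3) ∂sphereProb := by
    rw [← integral_neg]
    simp
  linarith [h2.symm.trans h]

theorem integrableOn_ball_mul_of_continuous {u F : E3 → ℝ} {B : ℝ} (z : E3) (R : ℝ)
    (hu : Measurable u) (hB : ∀ x, |u x| ≤ B) (hF : Continuous F) :
    IntegrableOn (fun x => u x * F x) (Metric.ball z R) := by
  have h1 : IntegrableOn F (Metric.ball z R) :=
    (hF.continuousOn.integrableOn_compact (isCompact_closedBall z R)).mono_set
      Metric.ball_subset_closedBall
  exact Integrable.bdd_mul h1 hu.aestronglyMeasurable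
    (Filter.Eventually.of_forall fun x => by simpa using hB x)

theorem setIntegral_ball_radial_mul_sphereAvg {u : ℝ → ℝ} {F : E3 → ℝ} {B : ℝ} (R : ℝ)
    (hu : Measurable u) (hB : ∀ r, |u r| ≤ B) (hF : Continuous F) :
    ∫ x in Metric.ball (0 : E3) R, u ‖x‖ * F x
      = ∫ x in Metric.ball (0 : E3) R, u ‖x‖ * sphereAvg F ‖x‖ := by
  have key : ∀ G : E3 → ℝ, (Metric.ball (0 : E3) R).indicator (fun x => u ‖x‖ * G x)
      = fun x => (Set.Iio R).indicator u ‖x‖ * G x := by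
    intro G
    ext x
    by_cases hx : ‖x‖ < R <;> simp [Set.indicator, hx]
  have hm : Measurable fun x : E3 => u ‖x‖ := hu.comp measurable_norm
  have h1 := (integrableOn_ball_mul_of_continuous 0 R hm (fun x => hB _) hF).integrable_indicator
    measurableSet_ball
  have h2 := (integrableOn_ball_mul_of_continuous 0 R hm (fun x => hB _)
    ((continuous_sphereAvg hF).comp continuous_norm)).integrable_indicator measurableSet_ball
  rw [← integral_indicator measurableSet_ball, ← integral_indicator measurableSet_ball,
    key, key]
  simp only [Function.comp_def] at h2
  rw [key] at h1 h2
  exact integral_radial_mul_sphereAvg _ F h1 h2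

/-! ### Regularity of radial functions -/

/-- Away from the origin, differentiate through `√(‖x‖ ^ 2)`, the squared norm being smooth. At the
origin the stated derivative is zero, and `g' 0 = 0` makes this correct although the norm is not
differentiable there. -/
theorem hasFDerivAt_radial {g g' : ℝ → ℝ} (hg : ∀ r, HasDerivAt g (g' r) r) (h0 : g' 0 = 0)
    (x : E3) : HasFDerivAt (fun x : E3 => g ‖x‖) ((g' ‖x‖ / ‖x‖) • innerSL ℝ x) x := by
  by_cases hx : x = 0
  · subst hx
    have h := (hg 0)
    rw [h0, hasDerivAt_iff_isLittleO_nhds_zero] at h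
    rw [hasFDerivAt_iff_isLittleO_nhds_zero]
    have ht : Filter.Tendsto (fun x : E3 => ‖x‖) (nhds 0) (nhds 0) := by
      simpa using continuous_norm.tendsto (0 : E3)
    have := (h.comp_tendsto ht)
    simp only [Function.comp_def, zero_add, smul_zero, sub_zero] at this
    simpa using this.of_norm_right
  · have hn : ‖x‖ ≠ 0 := norm_ne_zero_iff.2 hx
    have h1 : HasFDerivAt (fun x : E3 => √(‖x‖ ^ 2)) _ x :=
      (hasStrictFDerivAt_norm_sq x).hasFDerivAt.sqrt (by positivity)
    have h2 := (hg (√(‖x‖ ^ 2))).comp_hasFDerivAt x h1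
    simp only [Function.comp_def, Real.sqrt_sq (norm_nonneg _)] at h2
    have h3 : (g' ‖x‖ / ‖x‖) • innerSL ℝ x
        = g' ‖x‖ • (1 / (2 * ‖x‖)) • 2 • (innerSL ℝ) x := by
      rw [smul_smul, ← Nat.cast_smul_eq_nsmul ℝ, smul_smul]
      congr 1
      field_simp
      norm_num
    rw [h3]
    exact h2

theorem contDiff_radial {g g' : ℝ → ℝ} (hg : ∀ r, HasDerivAt g (g' r) r) (h0 : g' 0 = 0)
    (hg' : Continuous g') : ContDiff ℝ 1 (fun x : E3 => g ‖x‖) := by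
  rw [contDiff_one_iff_hasFDerivAt]
  refine ⟨_, ?_, hasFDerivAt_radial hg h0⟩
  rw [continuous_iff_continuousAt]
  intro x
  by_cases hx : x = 0
  · subst hx
    rw [ContinuousAt, tendsto_iff_norm_sub_tendsto_zero]
    have hc : Continuous fun x : E3 => |g' ‖x‖| := by fun_prop
    have hc0 := hc.tendsto 0
    simp only [norm_zero, h0, abs_zero] at hc0
    refine squeeze_zero (fun _ => norm_nonneg _) (fun y => ?_) hc0
    simp only [map_zero, smul_zero, sub_zero, norm_smul, innerSL_apply_norm, norm_div,
      Real.norm_eq_abs, abs_norm]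
    by_cases hy : ‖y‖ = 0
    · simp [hy]
    · rw [div_mul_cancel₀ _ hy]
  · have hn : ‖x‖ ≠ 0 := norm_ne_zero_iff.2 hx
    have h1 : ContinuousAt (fun x : E3 => g' ‖x‖ / ‖x‖) x :=
      (hg'.comp continuous_norm).continuousAt.div continuous_norm.continuousAt hn
    exact h1.smul (innerSL ℝ).continuous.continuousAt

/-! ### The local form inequality for arbitrary functions, centres and scales -/

theorem norm_fderiv_apply_sq_le_gradSq (ψ : E3 → ℂ) (x v : E3) :
    ‖fderiv ℝ ψ x v‖ ^ 2 ≤ gradSq ψ x * ‖v‖ ^ 2 := by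
  have hv : v = ∑ a : Fin 3, v a • EuclideanSpace.single a (1 : ℝ) := by
    ext b
    simp [Finset.sum_apply, Pi.single_apply]
  have h1 : ‖fderiv ℝ ψ x v‖ ≤
      ∑ a : Fin 3, ‖fderiv ℝ ψ x (EuclideanSpace.single a 1)‖ * |v a| := by
    conv_lhs => rw [hv]
    rw [map_sum]
    refine (norm_sum_le _ _).trans (Finset.sum_le_sum fun a _ => ?_)
    rw [map_smul, norm_smul, mul_comm, Real.norm_eq_abs]
  have h2 := Finset.sum_mul_sq_le_sq_mul_sq Finset.univ
    (fun a : Fin 3 => ‖fderiv ℝ ψ x (EuclideanSpace.single a 1)‖) (fun a => |v a|)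
  have h3 : ‖v‖ ^ 2 = ∑ a : Fin 3, |v a| ^ 2 := by
    rw [EuclideanSpace.norm_sq_eq]; simp
  rw [gradSq, h3]
  exact (pow_le_pow_left₀ (norm_nonneg _) h1 2).trans h2

theorem gradSq_nonneg (ψ : E3 → ℂ) (x : E3) : 0 ≤ gradSq ψ x :=
  Finset.sum_nonneg fun _ _ => by positivity

theorem continuous_gradSq {ψ : E3 → ℂ} (hψ : ContDiff ℝ 1 ψ) : Continuous (gradSq ψ) := by
  have := hψ.continuous_fderiv one_ne_zero
  unfold gradSq
  fun_prop

theorem gradSq_ofReal {f : E3 → ℝ} {x : E3} {p : ℝ}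
    (hf : HasFDerivAt f (p • innerSL ℝ x) x) :
    gradSq (fun y => (f y : ℂ)) x = p ^ 2 * ‖x‖ ^ 2 := by
  have h : HasFDerivAt (fun y => (f y : ℂ)) (Complex.ofRealCLM.comp (p • innerSL ℝ x)) x :=
    Complex.ofRealCLM.hasFDerivAt.comp x hf
  rw [gradSq, h.fderiv, EuclideanSpace.norm_sq_eq, Finset.mul_sum]
  refine Finset.sum_congr rfl fun a _ => ?_
  simp [EuclideanSpace.inner_single_right, mul_pow]

/-- The Cauchy-Schwarz inequality for the radial derivative of the spherical average of `|ψ|²`. -/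
theorem sphereAvg_deriv_sq_le {ψ : E3 → ℂ} (hψ : ContDiff ℝ 1 ψ) (r : ℝ) :
    (∫ ω : UnitSphere3, fderiv ℝ (fun x => ‖ψ x‖ ^ 2) (r • (ω : E3)) (ω : E3) ∂sphereProb) ^ 2
      ≤ 4 * sphereAvg (fun x => ‖ψ x‖ ^ 2) r * sphereAvg (gradSq ψ) r := by
  have hF : ContDiff ℝ 1 (fun x => ‖ψ x‖ ^ 2) := hψ.norm_sq ℝ
  have hcF : Continuous (fderiv ℝ (fun x => ‖ψ x‖ ^ 2)) := hF.continuous_fderiv one_ne_zero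
  have hcD := continuous_gradSq hψ
  have hcψ := hψ.continuous
  -- Discriminant argument: this quadratic in `t` dominates the spherical average of `‖t ψ + ∂_ω ψ‖
  -- ^ 2`, where `∂_ω` is the radial derivative.
  have key : ∀ t : ℝ, 0 ≤ sphereAvg (fun x => ‖ψ x‖ ^ 2) r * (t * t) +
      (∫ ω : UnitSphere3, fderiv ℝ (fun x => ‖ψ x‖ ^ 2) (r • (ω : E3)) (ω : E3) ∂sphereProb) * t
      + sphereAvg (gradSq ψ) r := by
    intro t
    simp only [sphereAvg]
    rw [← integral_mul_const, ← integral_mul_const, ← integral_add, ← integral_add]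
    · refine integral_nonneg fun ω => ?_
      have hd : HasFDerivAt ψ (fderiv ℝ ψ (r • (ω : E3))) (r • (ω : E3)) :=
        (hψ.differentiable one_ne_zero _).hasFDerivAt
      have h1 := hd.norm_sq.fderiv
      have h2 := norm_fderiv_apply_sq_le_gradSq ψ (r • (ω : E3)) ω
      rw [norm_eq_of_mem_sphere ω, one_pow, mul_one] at h2
      have h3 := norm_add_sq_real ((t : ℝ) • ψ (r • (ω : E3))) (fderiv ℝ ψ (r • (ω : E3)) ω)
      rw [norm_smul, mul_pow, real_inner_smul_left, Real.norm_eq_abs, sq_abs] at h3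
      simp only [h1, Pi.zero_apply]
      simp only [smul_apply, ContinuousLinearMap.comp_apply,
        innerSL_apply_apply, nsmul_eq_mul, Nat.cast_ofNat]
      have h4 := sq_nonneg ‖(t : ℝ) • ψ (r • (ω : E3)) + fderiv ℝ ψ (r • (ω : E3)) ω‖
      nlinarith
    all_goals exact integrable_sphereProb (by fun_prop)
  have := discrim_le_zero key
  rw [discrim] at this
  linarith

/-- If the form `∫_{B_R} (|∇φ|² + w(|x|)|φ|²)` is nonnegative on `C¹` functions that are `1` on the
sphere of radius `R`, then it is nonnegative on all `C¹` functions. -/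
theorem localForm_nonneg {w : ℝ → ℝ} {B R : ℝ} (hw : Measurable w)
    (hB : ∀ r, |w r| ≤ B)
    (H : ∀ φ : E3 → ℂ, ContDiff ℝ 1 φ → (∀ x, ‖x‖ = R → φ x = 1) →
      0 ≤ ∫ x in Metric.ball (0 : E3) R, (gradSq φ x + w ‖x‖ * ‖φ x‖ ^ 2))
    {ψ : E3 → ℂ} (hψ : ContDiff ℝ 1 ψ) :
    0 ≤ ∫ x in Metric.ball (0 : E3) R, (gradSq ψ x + w ‖x‖ * ‖ψ x‖ ^ 2) := by
  set F : E3 → ℝ := fun x => ‖ψ x‖ ^ 2 with hFdef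
  have hF : ContDiff ℝ 1 F := hψ.norm_sq ℝ
  have hcF : Continuous (fderiv ℝ F) := hF.continuous_fderiv one_ne_zero
  have hwm : Measurable fun x : E3 => w ‖x‖ := hw.comp measurable_norm
  set g := sphereAvg F with hgdef
  set h := sphereAvg (gradSq ψ) with hhdef
  set g' : ℝ → ℝ := fun r => ∫ ω : UnitSphere3, fderiv ℝ F (r • (ω : E3)) (ω : E3) ∂sphereProb
    with hg'def
  have hg : ∀ r, HasDerivAt g (g' r) r := sphereAvg_hasDerivAt hF
  have hgc : Continuous g := continuous_sphereAvg hF.continuous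
  have hhc : Continuous h := continuous_sphereAvg (continuous_gradSq hψ)
  have hg'c : Continuous g' := by
    have := continuous_parametric_integral_of_continuous (μ := sphereProb)
      (f := fun (r : ℝ) (ω : UnitSphere3) => fderiv ℝ F (r • (ω : E3)) (ω : E3))
      (by fun_prop) isCompact_univ
    simpa [hg'def] using! this
  have hg'0 : g' 0 = 0 := by
    simp only [hg'def, zero_smul]
    exact integral_clm_sphereProb _
  have hgnn : ∀ r, 0 ≤ g r := fun r => integral_nonneg fun ω => by positivity
  have hhnn : ∀ r, 0 ≤ h r := fun r => integral_nonneg fun ω => gradSq_nonneg _ _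
  have hCS : ∀ r, g' r ^ 2 ≤ 4 * g r * h r := sphereAvg_deriv_sq_le hψ
  have hIh : IntegrableOn (fun x : E3 => h ‖x‖) (Metric.ball 0 R) :=
    ((hhc.comp continuous_norm).continuousOn.integrableOn_compact
      (isCompact_closedBall (0 : E3) R)).mono_set Metric.ball_subset_closedBall
  have hIg : IntegrableOn (fun x : E3 => w ‖x‖ * g ‖x‖) (Metric.ball 0 R) :=
    integrableOn_ball_mul_of_continuous 0 R hwm (fun x => hB _) (hgc.comp continuous_norm)
  have hIw : IntegrableOn (fun x : E3 => w ‖x‖) (Metric.ball 0 R) := by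
    simpa using integrableOn_ball_mul_of_continuous 0 R hwm (fun x => hB _)
      (continuous_const (y := (1 : ℝ)))
  have hIhg : IntegrableOn (fun x : E3 => h ‖x‖ + w ‖x‖ * g ‖x‖) (Metric.ball 0 R) := hIh.add hIg
  -- The test function is `√(g + δ)` divided by its value at radius `R`, hence `1` on that sphere.
  -- The shift `δ` keeps the root differentiable where `g` vanishes, at the price of an error linear
  -- in `δ`.
  have step : ∀ δ : ℝ, 0 < δ → 0 ≤ (∫ x in Metric.ball (0 : E3) R, (h ‖x‖ + w ‖x‖ * g ‖x‖))
      + δ * ∫ x in Metric.ball (0 : E3) R, w ‖x‖ := by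
    intro δ hδ
    have hpos : ∀ r, 0 < g r + δ := fun r => by linarith [hgnn r]
    set c := √(g R + δ) with hc
    have hcpos : 0 < c := Real.sqrt_pos.2 (hpos R)
    set q : ℝ → ℝ := fun r => c⁻¹ * √(g r + δ) with hq
    set q' : ℝ → ℝ := fun r => c⁻¹ * (g' r / (2 * √(g r + δ))) with hq'
    have hqd : ∀ r, HasDerivAt q (q' r) r := fun r =>
      (((hg r).add_const δ).sqrt (hpos r).ne').const_mul _
    have hq'0 : q' 0 = 0 := by simp [hq', hg'0]
    have hq'c : Continuous q' := by
      refine continuous_const.mul (hg'c.div (by fun_prop) fun r => ?_)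
      have := Real.sqrt_pos.2 (hpos r)
      positivity
    set φ : E3 → ℂ := fun x => ((q ‖x‖ : ℝ) : ℂ) with hφ
    have hφC : ContDiff ℝ 1 φ :=
      Complex.ofRealCLM.contDiff.comp (contDiff_radial hqd hq'0 hq'c)
    have hφ1 : ∀ x, ‖x‖ = R → φ x = 1 := by
      intro x hx
      simp only [hφ, hq, hx]
      rw [← hc, inv_mul_cancel₀ hcpos.ne', Complex.ofReal_one]
    have hφn : ∀ x, ‖φ x‖ ^ 2 = (c ^ 2)⁻¹ * (g ‖x‖ + δ) := by
      intro x
      simp only [hφ, hq, Complex.norm_real, Real.norm_eq_abs, sq_abs, mul_pow, inv_pow]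
      rw [Real.sq_sqrt (hpos ‖x‖).le]
    -- Since `g' ^ 2 ≤ 4 g h`, the radial derivative of `√(g + δ)` has square `g' ^ 2 / (4 (g + δ))
    -- ≤ h`: averaging does not increase the gradient energy.
    have hφg : ∀ x, gradSq φ x ≤ (c ^ 2)⁻¹ * h ‖x‖ := by
      intro x
      rw [hφ, gradSq_ofReal (hasFDerivAt_radial hqd hq'0 x)]
      have h1 : (q' ‖x‖ / ‖x‖) ^ 2 * ‖x‖ ^ 2 ≤ q' ‖x‖ ^ 2 := by
        by_cases hx : ‖x‖ = 0
        · simp [hx]; positivity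
        · rw [← mul_pow, div_mul_cancel₀ _ hx]
      refine h1.trans ?_
      simp only [hq', mul_pow, inv_pow, div_pow]
      rw [Real.sq_sqrt (hpos ‖x‖).le]
      gcongr
      rw [div_le_iff₀ (by have := hpos ‖x‖; positivity)]
      nlinarith [hCS ‖x‖, hhnn ‖x‖]
    have h0 := H φ hφC hφ1
    have hI1 : IntegrableOn (fun x => gradSq φ x + w ‖x‖ * ‖φ x‖ ^ 2) (Metric.ball (0 : E3) R) := by
      refine Integrable.add ?_ ?_
      · exact ((continuous_gradSq hφC).continuousOn.integrableOn_compact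
          (isCompact_closedBall (0 : E3) R)).mono_set Metric.ball_subset_closedBall
      · exact integrableOn_ball_mul_of_continuous 0 R hwm (fun x => hB _)
          (hφC.continuous.norm.pow 2)
    have hI2 : IntegrableOn (fun x => (c ^ 2)⁻¹ * ((h ‖x‖ + w ‖x‖ * g ‖x‖) + δ * w ‖x‖))
        (Metric.ball (0 : E3) R) :=
      (hIhg.add (hIw.const_mul δ)).const_mul _
    have h1 : 0 ≤ ∫ x in Metric.ball (0 : E3) R,
        (c ^ 2)⁻¹ * ((h ‖x‖ + w ‖x‖ * g ‖x‖) + δ * w ‖x‖) := by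
      refine h0.trans (integral_mono hI1 hI2 fun x => ?_)
      have := hφg x
      simp only [hφn x]
      nlinarith
    rw [integral_const_mul, integral_add hIhg (hIw.const_mul δ),
      integral_const_mul] at h1
    exact nonneg_of_mul_nonneg_right h1 (by positivity)
  have hlim : 0 ≤ ∫ x in Metric.ball (0 : E3) R, (h ‖x‖ + w ‖x‖ * g ‖x‖) := by
    set a := ∫ x in Metric.ball (0 : E3) R, (h ‖x‖ + w ‖x‖ * g ‖x‖)
    set b := ∫ x in Metric.ball (0 : E3) R, w ‖x‖
    have ht : Filter.Tendsto (fun δ : ℝ => a + δ * b) (nhdsWithin 0 (Set.Ioi 0)) (nhds a) := by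
      have : Continuous fun δ : ℝ => a + δ * b := by fun_prop
      simpa using (this.tendsto 0).mono_left nhdsWithin_le_nhds
    exact ge_of_tendsto ht (Filter.eventually_of_mem self_mem_nhdsWithin fun δ hδ => step δ hδ)
  have e1 := setIntegral_ball_radial_mul_sphereAvg R (u := fun _ => 1) (B := 1) measurable_const
    (by simp) (continuous_gradSq hψ)
  have e2 := setIntegral_ball_radial_mul_sphereAvg R hw hB hF.continuous
  simp only [one_mul] at e1
  rw [integral_add, e1, e2, ← integral_add hIh hIg]
  · exact hlim
  · exact ((continuous_gradSq hψ).continuousOn.integrableOn_compact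
      (isCompact_closedBall (0 : E3) R)).mono_set Metric.ball_subset_closedBall
  · exact integrableOn_ball_mul_of_continuous 0 R hwm (fun x => hB _) hF.continuous

theorem gradSq_comp_affine {ψ : E3 → ℂ} (hψ : ContDiff ℝ 1 ψ) (s : ℝ) (z x : E3) :
    gradSq (fun x => ψ (z + s • x)) x = s ^ 2 * gradSq ψ (z + s • x) := by
  have h1 : HasFDerivAt (fun x : E3 => z + s • x) (s • ContinuousLinearMap.id ℝ E3) x :=
    ((hasFDerivAt_id x).const_smul s).const_add z
  have h2 : HasFDerivAt (fun x => ψ (z + s • x))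
      ((fderiv ℝ ψ (z + s • x)).comp (s • ContinuousLinearMap.id ℝ E3)) x :=
    ((hψ.differentiable one_ne_zero _).hasFDerivAt).comp x h1
  rw [gradSq, h2.fderiv, gradSq, Finset.mul_sum]
  refine Finset.sum_congr rfl fun a _ => ?_
  simp [mul_pow]

/-- The scaled and translated form of `localForm_nonneg`. -/
theorem localForm_nonneg_scaled {w : ℝ → ℝ} {R : ℝ}
    (H : ∀ ψ : E3 → ℂ, ContDiff ℝ 1 ψ →
      0 ≤ ∫ x in Metric.ball (0 : E3) R, (gradSq ψ x + w ‖x‖ * ‖ψ x‖ ^ 2))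
    {n : ℝ} (hn : 0 < n) (z : E3) {ψ : E3 → ℂ} (hψ : ContDiff ℝ 1 ψ) :
    0 ≤ ∫ y, {y : E3 | n * ‖y - z‖ < R}.indicator
      (fun y => gradSq ψ y + n ^ 2 * w (n * ‖y - z‖) * ‖ψ y‖ ^ 2) y := by
  have hψ' : ContDiff ℝ 1 (fun x => ψ (z + n⁻¹ • x)) :=
    hψ.comp (contDiff_const.add (contDiff_id.const_smul n⁻¹))
  have h0 := H _ hψ'
  set G : E3 → ℝ := {y : E3 | n * ‖y - z‖ < R}.indicator
      (fun y => gradSq ψ y + n ^ 2 * w (n * ‖y - z‖) * ‖ψ y‖ ^ 2) with hG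
  -- Substituting `y = z + n⁻¹ x` gives the gradient term a factor `n⁻²`. Pulling it out leaves `n²`
  -- in front of `w`; the Jacobian is a positive constant.
  have hpt : (Metric.ball (0 : E3) R).indicator (fun x =>
      gradSq (fun x => ψ (z + n⁻¹ • x)) x + w ‖x‖ * ‖ψ (z + n⁻¹ • x)‖ ^ 2)
      = fun x => (n ^ 2)⁻¹ * G (z + n⁻¹ • x) := by
    ext x
    have hnx : n * ‖z + n⁻¹ • x - z‖ = ‖x‖ := by
      rw [add_sub_cancel_left, norm_smul, Real.norm_of_nonneg (by positivity), ← mul_assoc,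
        mul_inv_cancel₀ hn.ne', one_mul]
    by_cases hx : ‖x‖ < R
    · rw [Set.indicator_of_mem (by simpa using hx), hG,
        Set.indicator_of_mem (by simpa only [Set.mem_ofPred_eq, hnx] using hx),
        gradSq_comp_affine hψ, hnx]
      field_simp
    · rw [Set.indicator_of_notMem (by simpa using hx), hG,
        Set.indicator_of_notMem (by simpa only [Set.mem_ofPred_eq, hnx] using hx), mul_zero]
  rw [← integral_indicator measurableSet_ball, hpt, integral_const_mul,
    Measure.integral_comp_smul volume (fun x => G (z + x)) n⁻¹,
    integral_add_left_eq_self G z, smul_eq_mul] at h0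
  have h1 := nonneg_of_mul_nonneg_right h0 (by positivity)
  exact nonneg_of_mul_nonneg_right h1 (by positivity)

/-! ### Counting interacting pairs -/

/-- The index of the grid cube that contains `y`. -/
noncomputable def cell (b : ℝ) (y : E3) : Fin 3 → ℤ := fun i => ⌊y i / (b / √3)⌋

theorem mem_gridCube_cell {b : ℝ} (hb : 0 < b) (y : E3) : y ∈ gridCube b (cell b y) := by
  intro i
  have hs : 0 < b / √3 := by positivity
  have h1 := Int.floor_le (y i / (b / √3))
  have h2 := (Int.lt_floor_add_one (y i / (b / √3))).le
  rw [le_div_iff₀ hs] at h1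
  rw [div_le_iff₀ hs] at h2
  simp only [cell]
  constructor <;> linarith

/-- A cube of side `b / √3` has diagonal `b`, and the half-open cells make the inequality strict.
Particles in a common cell thus lie inside the repulsive core. -/
theorem norm_sub_lt_of_cell_eq {b : ℝ} (hb : 0 < b) {y z : E3} (h : cell b y = cell b z) :
    ‖y - z‖ < b := by
  have hs : 0 < b / √3 := by positivity
  have h1 : ∀ i, (y i - z i) ^ 2 < (b / √3) ^ 2 := by
    intro i
    have := Int.abs_sub_lt_one_of_floor_eq_floor (congrFun h i)
    rw [← sub_div, abs_div, abs_of_pos hs, div_lt_one hs] at this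
    rw [← sq_abs (y i - z i)]
    exact pow_lt_pow_left₀ this (abs_nonneg _) two_ne_zero
  have h2 : ‖y - z‖ ^ 2 < b ^ 2 := by
    rw [EuclideanSpace.norm_sq_eq, Fin.sum_univ_three]
    simp only [PiLp.sub_apply, Real.norm_eq_abs, sq_abs]
    have h3 : (b / √3) ^ 2 = b ^ 2 / 3 := by rw [div_pow, Real.sq_sqrt (by norm_num)]
    have := h1 0
    have := h1 1
    have := h1 2
    linarith
  exact lt_of_pow_lt_pow_left₀ 2 hb.le h2

/-- Cells are half-open while `cubeNumber` counts closed cubes; the closed cube of each occupied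
cell meets the ball, which is all that is needed. -/
theorem card_image_cell_le_cubeNumber {ι : Type*} {b : ℝ} (hb : 0 < b) (ρ : ℝ) (x : E3)
    (y : ι → E3) (s : Finset ι) (hs : ∀ i ∈ s, ‖y i - x‖ < ρ) :
    (s.image fun i => cell b (y i)).card ≤ cubeNumber b ρ := by
  obtain ⟨hf, hbd⟩ := cubeNumber_wellDefined hb ρ
  refine le_trans ?_ (le_ciSup hbd x)
  rw [← Set.ncard_coe_finset]
  refine Set.ncard_le_ncard ?_ (hf x)
  intro n hn
  obtain ⟨i, hi, rfl⟩ := Finset.mem_image.1 (Finset.mem_coe.1 hn)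
  exact ⟨y i, mem_gridCube_cell hb _, by simpa [dist_eq_norm] using hs i hi⟩

theorem cubeNumber_pos {b ρ : ℝ} (hb : 0 < b) (hρ : 0 < ρ) : 0 < cubeNumber b ρ := by
  have := card_image_cell_le_cubeNumber hb ρ 0 (fun _ : Unit => 0) Finset.univ (by simpa using hρ)
  rw [Finset.card_image_of_injective _ (fun _ _ _ => rfl)] at this
  simpa using! this

/-- The label of `k` is not shared by any `i ≠ k`, apart possibly from `j`. -/
def Isolated {ι C : Type*} (c : ι → C) (j k : ι) : Prop := ∀ i, i ≠ j → i ≠ k → c i ≠ c k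

section Counting

variable {ι C : Type*}

open Classical in
/-- The indicator of `k ≠ j` being isolated apart from `j`. -/
noncomputable def goodInd (c : ι → C) (j k : ι) : ℝ := if j ≠ k ∧ Isolated c j k then 1 else 0

open Classical in
/-- The indicator of `k ≠ j` not being isolated apart from `j`. -/
noncomputable def badInd (c : ι → C) (j k : ι) : ℝ := if j ≠ k ∧ ¬ Isolated c j k then 1 else 0

open Classical in
theorem goodInd_add_badInd (c : ι → C) (j k : ι) :
    goodInd c j k + badInd c j k = if j ≠ k then 1 else 0 := by
  by_cases h : j = k <;> by_cases h' : Isolated c j k <;> simp [goodInd, badInd, h, h']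

theorem goodInd_nonneg (c : ι → C) (j k : ι) : 0 ≤ goodInd c j k := by
  unfold goodInd; split_ifs <;> norm_num

theorem badInd_nonneg (c : ι → C) (j k : ι) : 0 ≤ badInd c j k := by
  unfold badInd; split_ifs <;> norm_num

variable [Fintype ι]

open Classical in
/-- The number of indices with the same label as `k`. -/
noncomputable def labelCard (c : ι → C) (k : ι) : ℕ := (Finset.univ.filter fun i => c i = c k).card

open Classical in
-- Two different isolated partners of `j` cannot share a cell, so they are counted by the cells they
-- occupy in the ball around `y j`.
theorem sum_goodInd_le {b R : ℝ} (hb : 0 < b) (y : ι → E3) (j : ι) :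
    ∑ k, goodInd (fun i => cell b (y i)) j k * (if ‖y j - y k‖ < R then 1 else 0)
      ≤ cubeNumber b R := by
  set c := fun i => cell b (y i) with hc
  set s := Finset.univ.filter fun k => (j ≠ k ∧ Isolated c j k) ∧ ‖y j - y k‖ < R with hs
  have h1 : ∑ k, goodInd c j k * (if ‖y j - y k‖ < R then 1 else 0) = (s.card : ℝ) := by
    rw [hs, Finset.card_filter]
    push_cast
    refine Finset.sum_congr rfl fun k _ => ?_
    rw [goodInd]
    split_ifs <;> simp_all
  have h2 := card_image_cell_le_cubeNumber hb R (y j) y s (fun k hk => by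
    rw [norm_sub_rev]; exact (Finset.mem_filter.1 hk).2.2)
  rw [Finset.card_image_of_injOn] at h2
  · rw [h1]; exact_mod_cast h2
  · intro k hk k' hk' hkk
    by_contra hne
    have h3 := (Finset.mem_filter.1 (Finset.mem_coe.1 hk)).2.1
    have h4 := (Finset.mem_filter.1 (Finset.mem_coe.1 hk')).2.1
    exact h3.2 k' h4.1.symm (Ne.symm hne) hkk.symm

open Classical in
-- Group the particles by cell: each cell that occurs holds at most `m` of them, and at most
-- `cubeNumber b R` cells reach into the ball.
theorem card_near_le {b R : ℝ} (hb : 0 < b) (y : ι → E3) (x : E3) (m : ℕ) :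
    (Finset.univ.filter fun j => ‖y j - x‖ < R ∧ labelCard (fun i => cell b (y i)) j ≤ m).card
      ≤ m * cubeNumber b R := by
  refine (Finset.card_le_mul_card_image (f := fun i => cell b (y i)) _ m ?_).trans
    (Nat.mul_le_mul_left _ (card_image_cell_le_cubeNumber hb R x y _ fun i hi =>
      (Finset.mem_filter.1 hi).2.1))
  intro d hd
  obtain ⟨j, hj, rfl⟩ := Finset.mem_image.1 hd
  refine le_trans (Finset.card_le_card ?_) (Finset.mem_filter.1 hj).2.2
  intro i hi
  simpa using (Finset.mem_filter.1 hi).2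

open Classical in
theorem sum_ite_cell_eq (c : ι → C) (k : ι) :
    ∑ j, (if j ≠ k ∧ c j = c k then (1 : ℝ) else 0) = labelCard c k - 1 := by
  have h : ∀ j, (if j ≠ k ∧ c j = c k then (1 : ℝ) else 0)
      = (if c j = c k then 1 else 0) - (if j = k then 1 else 0) := by
    intro j
    by_cases h1 : j = k
    · subst h1; simp
    · simp [h1]
  simp only [h, Finset.sum_sub_distrib, Finset.sum_ite_eq', Finset.mem_univ, if_true]
  rw [labelCard, Finset.card_filter]
  push_cast
  rfl

theorem one_le_labelCard (c : ι → C) (k : ι) : 1 ≤ labelCard c k :=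
  Finset.card_pos.2 ⟨k, by simp⟩

theorem two_le_labelCard {c : ι → C} {j k : ι} (h : ¬ Isolated c j k) : 2 ≤ labelCard c k := by
  simp only [Isolated, not_forall, not_not] at h
  obtain ⟨i, -, hik, hc⟩ := h
  exact Finset.one_lt_card.2 ⟨i, by simp [hc], k, by simp, hik⟩

open Classical in
/-- The number of non-isolated pairs at distance less than `R` is controlled by the number of pairs
in a common cube. -/
theorem sum_badInd_le {b R : ℝ} (hb : 0 < b) (y : ι → E3) :
    ∑ j, ∑ k, badInd (fun i => cell b (y i)) j k * (if ‖y j - y k‖ < R then 1 else 0)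
      ≤ 4 * cubeNumber b R *
        ∑ j, ∑ k, (if j ≠ k ∧ cell b (y j) = cell b (y k) then (1 : ℝ) else 0) := by
  set c := fun i => cell b (y i) with hc
  set n := cubeNumber b R with hn
  -- For a cell with `m ≥ 2` particles, `m ≤ 2 (m - 1)`: the occupation number is at most twice the
  -- number of companions of `k`.
  have near : ∀ k, ∑ j, (if ‖y j - y k‖ < R ∧ labelCard c j ≤ labelCard c k ∧ 2 ≤ labelCard c k
      then (1 : ℝ) else 0) ≤ 2 * n * (labelCard c k - 1) := by
    intro k
    by_cases h2 : 2 ≤ labelCard c k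
    · have h3 := card_near_le (R := R) hb y (y k) (labelCard c k)
      rw [← hc, ← hn] at h3
      have h4 : ∑ j, (if ‖y j - y k‖ < R ∧ labelCard c j ≤ labelCard c k ∧ 2 ≤ labelCard c k
          then (1 : ℝ) else 0) = ((Finset.univ.filter fun j => ‖y j - y k‖ < R ∧
            labelCard c j ≤ labelCard c k).card : ℝ) := by
        rw [Finset.card_filter]; push_cast; simp [h2]
      rw [h4]
      have h5 : ((Finset.univ.filter fun j => ‖y j - y k‖ < R ∧
            labelCard c j ≤ labelCard c k).card : ℝ) ≤ labelCard c k * n := by exact_mod_cast h3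
      have h6 : (2 : ℝ) ≤ labelCard c k := by exact_mod_cast h2
      nlinarith [(Nat.cast_nonneg n : (0 : ℝ) ≤ n)]
    · have h6 : (1 : ℝ) ≤ labelCard c k := by exact_mod_cast one_le_labelCard c k
      simp only [h2, and_false, if_false, Finset.sum_const_zero]
      have : (0 : ℝ) ≤ labelCard c k - 1 := by linarith
      positivity
  -- Each bad pair is charged to its member in the fuller cell. The cell of `k` holds at least two
  -- particles, so the fuller one does too, even if it is that of `j`.
  have hpt : ∀ j k, badInd c j k * (if ‖y j - y k‖ < R then 1 else 0) ≤
      (if ‖y j - y k‖ < R ∧ labelCard c j ≤ labelCard c k ∧ 2 ≤ labelCard c k then (1 : ℝ) else 0)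
      + (if ‖y k - y j‖ < R ∧ labelCard c k ≤ labelCard c j ∧ 2 ≤ labelCard c j
        then (1 : ℝ) else 0) := by
    intro j k
    rw [norm_sub_rev (y k)]
    by_cases hI : j ≠ k ∧ ¬ Isolated c j k
    · have h2 := two_le_labelCard hI.2
      simp only [badInd, hI, not_false_eq_true, and_self, ne_eq, if_true, one_mul]
      by_cases hd : ‖y j - y k‖ < R
      · rcases le_total (labelCard c j) (labelCard c k) with h | h
        · simp only [hd, h, h2, and_self, if_true]
          split_ifs <;> norm_num
        · simp only [hd, h, h2.trans h, and_self, if_true]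
          split_ifs <;> norm_num
      · simp [hd]
    · have : badInd c j k = 0 := by simp only [badInd, hI, if_false]
      rw [this, zero_mul]
      split_ifs <;> norm_num
  calc _ ≤ ∑ j, ∑ k, ((if ‖y j - y k‖ < R ∧ labelCard c j ≤ labelCard c k ∧ 2 ≤ labelCard c k
          then (1 : ℝ) else 0) + (if ‖y k - y j‖ < R ∧ labelCard c k ≤ labelCard c j ∧
          2 ≤ labelCard c j then (1 : ℝ) else 0)) :=
        Finset.sum_le_sum fun j _ => Finset.sum_le_sum fun k _ => hpt j k
    _ = 2 * ∑ k, ∑ j, (if ‖y j - y k‖ < R ∧ labelCard c j ≤ labelCard c k ∧ 2 ≤ labelCard c k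
          then (1 : ℝ) else 0) := by
        simp only [Finset.sum_add_distrib]
        rw [Finset.sum_comm, two_mul]
    _ ≤ 2 * ∑ k, 2 * n * ((labelCard c k : ℝ) - 1) := by
        gcongr with k _
        exact near k
    _ = _ := by
        rw [Finset.sum_comm (s := Finset.univ) (t := Finset.univ)
          (f := fun j k => if j ≠ k ∧ cell b (y j) = cell b (y k) then (1 : ℝ) else 0)]
        have := sum_ite_cell_eq c
        simp only [hc] at this ⊢
        simp only [this, ← Finset.mul_sum]
        ring

open Classical in
/-- The attraction between non-isolated pairs is controlled by the repulsion. -/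
theorem sum_badInd_mul_le {b R lam Lam : ℝ} (hb : 0 < b) (hLam : 0 < Lam) (hlam : 0 ≤ lam)
    {vm vp : ℝ → ℝ} (hm : ∀ r, vm r ≤ if r < R then lam else 0) (hp0 : ∀ r, 0 ≤ vp r)
    (hp : ∀ r, r < b → Lam ≤ vp r) (y : ι → E3) :
    ∑ j, ∑ k, badInd (fun i => cell b (y i)) j k * vm ‖y j - y k‖
      ≤ 4 * cubeNumber b R * lam / Lam *
        ∑ j, ∑ k, (if j ≠ k then 1 else 0) * vp ‖y j - y k‖ := by
  set c := fun i => cell b (y i) with hc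
  calc _ ≤ ∑ j, ∑ k, lam * (badInd c j k * (if ‖y j - y k‖ < R then 1 else 0)) := by
        refine Finset.sum_le_sum fun j _ => Finset.sum_le_sum fun k _ => ?_
        have h1 := mul_le_mul_of_nonneg_left (hm ‖y j - y k‖) (badInd_nonneg c j k)
        refine h1.trans (le_of_eq ?_)
        split_ifs <;> ring
    _ = lam * ∑ j, ∑ k, badInd c j k * (if ‖y j - y k‖ < R then 1 else 0) := by
        simp only [Finset.mul_sum]
    _ ≤ lam * (4 * cubeNumber b R *
        ∑ j, ∑ k, (if j ≠ k ∧ cell b (y j) = cell b (y k) then (1 : ℝ) else 0)) :=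
        mul_le_mul_of_nonneg_left (sum_badInd_le hb y) hlam
    -- Particles in a common cell are at distance less than `b`, where the repulsion is at least
    -- `Lam`.
    _ ≤ lam * (4 * cubeNumber b R *
        ∑ j, ∑ k, Lam⁻¹ * ((if j ≠ k then 1 else 0) * vp ‖y j - y k‖)) := by
        gcongr with j _ k _
        by_cases hjk : j ≠ k ∧ cell b (y j) = cell b (y k)
        · simp only [hjk, ne_eq, not_false_eq_true, and_self, if_true, one_mul]
          rw [le_inv_mul_iff₀ hLam, mul_one]
          exact hp _ (norm_sub_lt_of_cell_eq hb hjk.2)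
        · simp only [hjk, if_false]
          have := hp0 ‖y j - y k‖
          split_ifs <;> positivity
    _ = _ := by
        simp only [← Finset.mul_sum]
        field_simp

end Counting

/-! ### Approximation of `H²` functions by Schwartz functions -/

section Approximation

open Filter Topology

variable {N : ℕ}

theorem inner_toLp_lineDeriv (f h : 𝓢(Config N, ℂ)) (m : Config N) :
    inner ℂ (f.toLp 2 volume) ((∂_{m} h).toLp 2 volume)
      = -inner ℂ ((∂_{m} f).toLp 2 volume) (h.toLp 2 volume) := by
  have := SchwartzMap.integral_bilinear_lineDerivOp_right_eq_neg_left (μ := volume) f h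
    ((ContinuousLinearMap.mul ℝ ℂ).comp (Complex.conjCLE : ℂ →L[ℝ] ℂ)) m
  refine (SchwartzMap.inner_toL2_toL2_eq f (∂_{m} h) volume).trans ?_
  refine Eq.trans ?_ (congrArg Neg.neg (SchwartzMap.inner_toL2_toL2_eq (∂_{m} f) h volume).symm)
  simpa [mul_comm] using this

/-- The total kinetic energy `∑_j ‖∇_j f‖²` of a Schwartz function. -/
noncomputable def kineticSq (f : 𝓢(Config N, ℂ)) : ℝ :=
  ∑ p : Fin N × Fin 3,
    ‖(∂_{(EuclideanSpace.single p 1 : Config N)} f).toLp 2 volume‖ ^ 2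

theorem inner_toLp_laplacian (f : 𝓢(Config N, ℂ)) :
    inner ℂ (f.toLp 2 volume) ((Δ f).toLp 2 volume) = -((kineticSq f : ℝ) : ℂ) := by
  have h1 : (Δ f).toLp 2 volume = ∑ p : Fin N × Fin 3,
      (∂_{(EuclideanSpace.single p 1 : Config N)} (∂_{(EuclideanSpace.single p 1 : Config N)} f)).toLp
        2 (volume : Measure (Config N)) := by
    rw [SchwartzMap.laplacian_eq_sum (EuclideanSpace.basisFun (Fin N × Fin 3) ℝ)]
    simp only [EuclideanSpace.basisFun_apply]
    rw [← SchwartzMap.toLpCLM_apply (𝕜 := ℂ), map_sum]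
    rfl
  rw [h1, inner_sum, kineticSq]
  push_cast
  rw [← Finset.sum_neg_distrib]
  refine Finset.sum_congr rfl fun p _ => ?_
  rw [inner_toLp_lineDeriv, inner_self_eq_norm_sq_to_K]
  simp

/-- The cross term is the kinetic energy. For `c > 0` all three terms are nonnegative, so
convergence of `f - c Δ f` in `L²` controls `f`, its first derivatives and its Laplacian at once. -/
theorem norm_toLp_sub_smul_laplacian_sq (f : 𝓢(Config N, ℂ)) (c : ℝ) :
    ‖(f - c • Δ f).toLp 2 volume‖ ^ 2
      = ‖f.toLp 2 volume‖ ^ 2 + 2 * c * kineticSq f + c ^ 2 * ‖(Δ f).toLp 2 volume‖ ^ 2 := by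
  have h1 : (f - c • Δ f).toLp 2 (volume : Measure (Config N))
      = f.toLp 2 volume - (c : ℂ) • (Δ f).toLp 2 volume := by
    have h2 : c • Δ f = (c : ℂ) • Δ f := by ext x; simp
    rw [h2, ← SchwartzMap.toLpCLM_apply (𝕜 := ℂ), map_sub, map_smul]
    rfl
  rw [h1, @norm_sub_sq ℂ, inner_smul_right, inner_toLp_laplacian, norm_smul, mul_pow, Complex.norm_real,
    Real.norm_eq_abs, sq_abs]
  simp
  ring

theorem kineticSq_nonneg (f : 𝓢(Config N, ℂ)) : 0 ≤ kineticSq f :=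
  Finset.sum_nonneg fun _ _ => by positivity

theorem cauchySeq_of_dist_sq_le {α β : Type*} [PseudoMetricSpace α] [PseudoMetricSpace β]
    {u : ℕ → α} {v : ℕ → β} (hv : CauchySeq v) {C : ℝ} (hC : 0 < C)
    (h : ∀ m n, C * dist (u m) (u n) ^ 2 ≤ dist (v m) (v n) ^ 2) : CauchySeq u := by
  rw [Metric.cauchySeq_iff] at hv ⊢
  intro ε hε
  obtain ⟨M, hM⟩ := hv (√C * ε) (by positivity)
  refine ⟨M, fun m hm n hn => ?_⟩
  have h1 := hM m hm n hn
  have h2 : (√C * dist (u m) (u n)) ^ 2 ≤ dist (v m) (v n) ^ 2 := by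
    rw [mul_pow, Real.sq_sqrt hC.le]; exact h m n
  have h3 := le_of_sq_le_sq h2 dist_nonneg
  exact lt_of_mul_lt_mul_left (h3.trans_lt h1) (Real.sqrt_nonneg _)

theorem coe_toLp_eq (f : 𝓢(Config N, ℂ)) :
    ((f.toLp 2 volume : WaveFn N) : 𝓢'(Config N, ℂ))
      = SchwartzMap.toTemperedDistributionCLM (Config N) ℂ volume f :=
  Lp.toTemperedDistribution_toLp_eq f

theorem tendsto_coe_of_tendsto {u : ℕ → WaveFn N} {Φ : WaveFn N} (h : Tendsto u atTop (𝓝 Φ)) :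
    Tendsto (fun n => (u n : 𝓢'(Config N, ℂ))) atTop (𝓝 (Φ : 𝓢'(Config N, ℂ))) :=
  ((Lp.toTemperedDistributionCLM ℂ (volume : Measure (Config N)) 2).continuous.tendsto Φ).comp h

theorem coe_injective {Φ Ψ : WaveFn N} (h : (Φ : 𝓢'(Config N, ℂ)) = (Ψ : 𝓢'(Config N, ℂ))) :
    Φ = Ψ :=
  LinearMap.ker_eq_bot.1 (Lp.ker_toTemperedDistributionCLM_eq_bot (E := Config N) (F := ℂ)
    (μ := volume) (p := 2)) h

/-- If a distributional partial derivative of the limit is known to be in `L²`, it is the limit of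
the partial derivatives. -/
theorem eq_partialL2_of_tendsto {Ψ G : WaveFn N} (hΨ : MemH2 Ψ) {f : ℕ → 𝓢(Config N, ℂ)}
    (hf : Tendsto (fun n => (f n).toLp 2 volume) atTop (𝓝 Ψ)) (j : Fin N) (a : Fin 3)
    (hG : Tendsto (fun n => (∂_{(EuclideanSpace.single (j, a) 1 : Config N)} (f n)).toLp 2 volume)
      atTop (𝓝 G)) : G = partialL2 j a Ψ := by
  refine coe_injective ?_
  rw [← hΨ.partialL2_eq]
  refine tendsto_nhds_unique (tendsto_coe_of_tendsto hG) ?_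
  have h := ((LineDeriv.lineDerivOpCLM ℂ 𝓢'(Config N, ℂ)
    (EuclideanSpace.single (j, a) 1 : Config N)).continuous.tendsto _).comp
      (tendsto_coe_of_tendsto hf)
  simp only [LineDeriv.lineDerivOpCLM_apply] at h
  refine h.congr fun n => ?_
  simp only [Function.comp_apply, coe_toLp_eq, LineDeriv.lineDerivOpCLM_apply]
  exact TemperedDistribution.lineDerivOp_toTemperedDistributionCLM_eq _ _

theorem eq_laplacianL2_of_tendsto {Ψ G : WaveFn N} (hΨ : MemH2 Ψ) {f : ℕ → 𝓢(Config N, ℂ)}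
    (hf : Tendsto (fun n => (f n).toLp 2 volume) atTop (𝓝 Ψ))
    (hG : Tendsto (fun n => (Δ (f n)).toLp 2 volume) atTop (𝓝 G)) : G = laplacianL2 Ψ := by
  refine coe_injective ?_
  rw [← hΨ.laplacianL2_eq]
  refine tendsto_nhds_unique (tendsto_coe_of_tendsto hG) ?_
  have h := ((LineDeriv.laplacianCLM ℂ (Config N) 𝓢'(Config N, ℂ)).continuous.tendsto _).comp
      (tendsto_coe_of_tendsto hf)
  simp only [TemperedDistribution.laplacianCLM_apply] at h
  refine h.congr fun n => ?_
  simp only [Function.comp_apply, coe_toLp_eq, TemperedDistribution.laplacianCLM_apply]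
  exact TemperedDistribution.laplacian_toTemperedDistributionCLM_eq _

/-- Schwartz functions are dense in `H²`. -/
theorem MemH2.exists_schwartz_tendsto {Ψ : WaveFn N} (hΨ : MemH2 Ψ) :
    ∃ f : ℕ → 𝓢(Config N, ℂ),
      Tendsto (fun n => (f n).toLp 2 volume) atTop (𝓝 Ψ) ∧
      (∀ j a, Tendsto
        (fun n => (∂_{(EuclideanSpace.single (j, a) 1 : Config N)} (f n)).toLp 2 volume)
        atTop (𝓝 (partialL2 j a Ψ))) ∧
      Tendsto (fun n => (Δ (f n)).toLp 2 volume) atTop (𝓝 (laplacianL2 Ψ)) := by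
  -- Here `g` is the `L²` function with Fourier transform `(1 + |ξ|²) Ψ̂`. Schwartz functions `s n`
  -- tending to `g` give the approximants of `Ψ` through the inverse multiplier `m = (1 + |ξ|²)⁻¹`.
  obtain ⟨g, hg⟩ := id hΨ
  have hgcl : g ∈ closure (Set.range (SchwartzMap.toLpCLM ℝ (E := Config N) ℂ 2 volume)) :=
    SchwartzMap.denseRange_toLpCLM (by norm_num) g
  obtain ⟨u, hu, hut⟩ := mem_closure_iff_seq_limit.1 hgcl
  choose s hs using hu
  have hst : Tendsto (fun n => (s n).toLp 2 volume) atTop (𝓝 g) := by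
    refine hut.congr fun n => ?_
    rw [← hs n, SchwartzMap.toLpCLM_apply]
  set m : Config N → ℂ := fun x => ((1 + ‖x‖ ^ 2) ^ ((-2 : ℝ) / 2) : ℝ) with hm
  have hmt : m.HasTemperateGrowth := by simp only [hm]; fun_prop
  set A := SchwartzMap.fourierMultiplierCLM (𝕜 := ℂ) (E := Config N) ℂ m with hA
  -- With this Fourier convention `Δ` has symbol `-(2π)² |ξ|²`, so `1 - c Δ` has symbol `1 + |ξ|²`
  -- and inverts `A`.
  set c : ℝ := ((2 * Real.pi) ^ 2)⁻¹ with hc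
  have hcpos : 0 < c := by positivity
  have hinv : ∀ h : 𝓢(Config N, ℂ), A h - c • Δ (A h) = h := by
    intro h
    have h1 := SchwartzMap.laplacian_eq_fourierMultiplierCLM (A h)
    rw [← SchwartzMap.fourierMultiplierCLM_ofReal ℂ (by fun_prop)] at h1
    have h2 : SchwartzMap.fourierMultiplierCLM (𝕜 := ℂ) (E := Config N) ℂ (fun _ => 1) (A h)
        + SchwartzMap.fourierMultiplierCLM (𝕜 := ℂ) (E := Config N) ℂ
          (fun x => ((‖x‖ ^ 2 : ℝ) : ℂ)) (A h) = h := by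
      rw [hA, SchwartzMap.fourierMultiplierCLM_fourierMultiplierCLM_apply (by fun_prop) hmt,
        SchwartzMap.fourierMultiplierCLM_fourierMultiplierCLM_apply (by fun_prop) hmt]
      simp only [SchwartzMap.fourierMultiplierCLM_apply]
      rw [← FourierTransform.fourierInv_add]
      have h3 : SchwartzMap.smulLeftCLM ℂ ((fun _ => 1) * m) (FourierTransform.fourier h)
          + SchwartzMap.smulLeftCLM ℂ ((fun x => ((‖x‖ ^ 2 : ℝ) : ℂ)) * m)
            (FourierTransform.fourier h) = FourierTransform.fourier h := by
        ext x
        rw [add_apply, SchwartzMap.smulLeftCLM_apply_apply (by fun_prop),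
          SchwartzMap.smulLeftCLM_apply_apply (by fun_prop), ← add_smul]
        have h4 : (((fun _ => 1) * m : Config N → ℂ) x
            + ((fun x => ((‖x‖ ^ 2 : ℝ) : ℂ)) * m : Config N → ℂ) x) = 1 := by
          simp only [Pi.mul_apply, ← add_mul, hm]
          have : (-2 : ℝ) / 2 = -1 := by norm_num
          rw [← Complex.ofReal_one, ← Complex.ofReal_add, ← Complex.ofReal_mul, this, Real.rpow_neg_one, mul_inv_cancel₀ (by positivity)]
        rw [h4, one_smul]
      rw [h3, FourierTransform.fourierInv_fourier_eq]
    rw [SchwartzMap.fourierMultiplierCLM_const] at h2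
    rw [h1, smul_smul]
    have h5 : c * -(2 * Real.pi) ^ 2 = -1 := by
      rw [hc]; field_simp
    rw [h5]
    conv_rhs => rw [← h2]
    simp
  set f : ℕ → 𝓢(Config N, ℂ) := fun n => A (s n) with hf
  have hcs : CauchySeq fun n => (s n).toLp 2 (volume : Measure (Config N)) := hst.cauchySeq
  have key : ∀ a b, dist ((s a).toLp 2 (volume : Measure (Config N))) ((s b).toLp 2 volume) ^ 2
      = ‖(f a - f b).toLp 2 (volume : Measure (Config N))‖ ^ 2 + 2 * c * kineticSq (f a - f b)
        + c ^ 2 * ‖(Δ (f a - f b)).toLp 2 (volume : Measure (Config N))‖ ^ 2 := by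
    intro a b
    rw [← norm_toLp_sub_smul_laplacian_sq, dist_eq_norm]
    have : f a - f b - c • Δ (f a - f b) = s a - s b := by
      simp only [hf, ← map_sub]
      exact hinv _
    rw [this]
    rfl
  have e1 : CauchySeq fun n => (f n).toLp 2 (volume : Measure (Config N)) := by
    refine cauchySeq_of_dist_sq_le hcs one_pos fun a b => ?_
    rw [key a b, one_mul, dist_eq_norm]
    have h1 := kineticSq_nonneg (f a - f b)
    have h2 : (f a - f b).toLp 2 (volume : Measure (Config N))
      = (f a).toLp 2 volume - (f b).toLp 2 volume := rfl
    rw [h2]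
    have : 0 ≤ 2 * c * kineticSq (f a - f b)
        + c ^ 2 * ‖(Δ (f a - f b)).toLp 2 (volume : Measure (Config N))‖ ^ 2 := by positivity
    linarith
  have e2 : ∀ p : Fin N × Fin 3, CauchySeq fun n =>
      (∂_{(EuclideanSpace.single p 1 : Config N)} (f n)).toLp 2 (volume : Measure (Config N)) := by
    intro p
    refine cauchySeq_of_dist_sq_le hcs (by positivity : 0 < 2 * c) fun a b => ?_
    rw [key a b, dist_eq_norm]
    have h2 : ‖(∂_{(EuclideanSpace.single p 1 : Config N)} (f a)).toLp 2
          (volume : Measure (Config N))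
        - (∂_{(EuclideanSpace.single p 1 : Config N)} (f b)).toLp 2 volume‖ ^ 2
        ≤ kineticSq (f a - f b) := by
      have h3 := Finset.single_le_sum (f := fun p : Fin N × Fin 3 =>
        ‖(∂_{(EuclideanSpace.single p 1 : Config N)} (f a - f b)).toLp 2
          (volume : Measure (Config N))‖ ^ 2) (fun _ _ => by positivity) (Finset.mem_univ p)
      refine le_trans (le_of_eq ?_) h3
      rw [show ∂_{(EuclideanSpace.single p 1 : Config N)} (f a - f b)
        = ∂_{(EuclideanSpace.single p 1 : Config N)} (f a)
          - ∂_{(EuclideanSpace.single p 1 : Config N)} (f b) from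
        map_sub (LineDeriv.lineDerivOpCLM ℝ 𝓢(Config N, ℂ) (EuclideanSpace.single p 1 : Config N)) (f a)
          (f b)]
      rfl
    have : 0 ≤ ‖(f a - f b).toLp 2 (volume : Measure (Config N))‖ ^ 2
        + c ^ 2 * ‖(Δ (f a - f b)).toLp 2 (volume : Measure (Config N))‖ ^ 2 := by positivity
    nlinarith
  have e3 : CauchySeq fun n => (Δ (f n)).toLp 2 (volume : Measure (Config N)) := by
    refine cauchySeq_of_dist_sq_le hcs (by positivity : 0 < c ^ 2) fun a b => ?_
    rw [key a b, dist_eq_norm]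
    have h2 : (Δ (f a)).toLp 2 (volume : Measure (Config N)) - (Δ (f b)).toLp 2 volume
        = (Δ (f a - f b)).toLp 2 volume := by
      have : Δ (f a - f b) = Δ (f a) - Δ (f b) :=
        map_sub (LineDeriv.laplacianCLM ℝ (Config N) 𝓢(Config N, ℂ)) (f a) (f b)
      rw [this]
      rfl
    rw [h2]
    have h1 := kineticSq_nonneg (f a - f b)
    have : 0 ≤ ‖(f a - f b).toLp 2 (volume : Measure (Config N))‖ ^ 2
        + 2 * c * kineticSq (f a - f b) := by positivity
    linarith
  obtain ⟨F, hF⟩ := cauchySeq_tendsto_of_complete e1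
  -- The inverse multiplier is continuous on tempered distributions and sends `g` to `Ψ`, which
  -- identifies the limit.
  have hFΨ : F = Ψ := by
    refine coe_injective (tendsto_nhds_unique (tendsto_coe_of_tendsto hF) ?_)
    have h1 := ((TemperedDistribution.besselPotential (Config N) ℂ (-2)).continuous.tendsto _).comp
      (tendsto_coe_of_tendsto hst)
    rw [(TemperedDistribution.besselPotential_neg_apply_eq_iff _ _ _).2 hg] at h1
    refine h1.congr fun n => ?_
    simp only [Function.comp_apply, coe_toLp_eq, TemperedDistribution.besselPotential, hf, hA]
    exact TemperedDistribution.fourierMultiplierCLM_toTemperedDistributionCLM_eq hmt _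
  rw [hFΨ] at hF
  refine ⟨f, hF, fun j a => ?_, ?_⟩
  · obtain ⟨G, hG⟩ := cauchySeq_tendsto_of_complete (e2 (j, a))
    rwa [eq_partialL2_of_tendsto hΨ hF j a hG] at hG
  · obtain ⟨G, hG⟩ := cauchySeq_tendsto_of_complete e3
    rwa [eq_laplacianL2_of_tendsto hΨ hF hG] at hG

end Approximation

/-! ### The many-body inequality for Schwartz functions -/

section Fibers

variable {N : ℕ}

/-- The displacement of the `j`-th particle by `y`. -/
noncomputable def shift (j : Fin N) : E3 →L[ℝ] Config N :=
  LinearMap.toContinuousLinearMap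
    { toFun := fun y => WithLp.toLp 2 fun p => if p.1 = j then y p.2 else 0
      map_add' := fun x y => by
        ext p
        by_cases h : p.1 = j <;> simp [h]
      map_smul' := fun c y => by
        ext p
        by_cases h : p.1 = j <;> simp [h] }

theorem shift_apply (j : Fin N) (y : E3) (p : Fin N × Fin 3) :
    shift j y p = if p.1 = j then y p.2 else 0 := rfl

theorem shift_single (j : Fin N) (a : Fin 3) :
    shift j (EuclideanSpace.single a 1) = EuclideanSpace.single (j, a) 1 := by
  ext ⟨i, b⟩
  rw [shift_apply]
  by_cases h : i = j <;> by_cases h' : b = a <;> simp [h, h']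

theorem pos_add_shift_self (X : Config N) (j : Fin N) (y : E3) :
    pos (X + shift j y) j = pos X j + y := by
  ext a
  simp [pos, shift_apply]

theorem pos_add_shift_of_ne (X : Config N) {j k : Fin N} (h : k ≠ j) (y : E3) :
    pos (X + shift j y) k = pos X k := by
  ext a
  simp [pos, shift_apply, h]

theorem continuous_pos (j : Fin N) : Continuous fun X : Config N => pos X j := by
  unfold pos
  fun_prop

/-- A function on configuration space has nonnegative integral if its integrals over the position
of one particle are nonnegative. -/
theorem integral_nonneg_of_fibers {F : Config N → ℝ} (hF : Integrable F) (j : Fin N)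
    (h : ∀ X, 0 ≤ ∫ y, F (X + shift j y)) : 0 ≤ ∫ X, F X := by
  -- Instead of splitting coordinates, `F X` is multiplied by the bump `χ (x_j - y)` of fixed mass
  -- and integrated over `y`. The shear `(y, X) ↦ (y, X + shift j y)` preserves volume and turns the
  -- bump into `χ (x_j)`, independent of `y`; the inner integral is then a fibre integral.
  set χ : E3 → ℝ := (Metric.ball (0 : E3) 1).indicator 1 with hχ
  have hχm : Measurable χ := measurable_one.indicator measurableSet_ball
  have hχ0 : ∀ x, 0 ≤ χ x := fun x => Set.indicator_nonneg (fun _ _ => zero_le_one) x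
  have hχi : Integrable χ := by
    rw [hχ, integrable_indicator_iff measurableSet_ball]
    exact integrableOn_const measure_ball_lt_top.ne (by simp)
  set V : ℝ := ∫ y, χ y with hV
  have hVpos : 0 < V := by
    rw [hV, hχ, integral_indicator_one measurableSet_ball]
    exact ENNReal.toReal_pos (Metric.measure_ball_pos _ _ one_pos).ne' measure_ball_lt_top.ne
  have hpm : Measurable fun X : Config N => pos X j := (continuous_pos j).measurable
  have hmp : MeasurePreserving (fun p : E3 × Config N => (p.1, p.2 + shift j p.1))
      (volume.prod volume) (volume.prod volume) := by
    refine (MeasurePreserving.id volume).skew_product (g := fun y X => X + shift j y) ?_ ?_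
    · exact (by fun_prop : Continuous fun p : E3 × Config N => p.2 + shift j p.1).measurable
    · exact Filter.Eventually.of_forall fun y => map_add_right_eq_self volume (shift j y)
  set Φ : E3 × Config N → ℝ := fun p => F p.2 * χ (pos p.2 j - p.1) with hΦ
  have hΦi : Integrable Φ (volume.prod volume) := by
    have hm : AEStronglyMeasurable Φ (volume.prod volume) := by
      refine (hF.aestronglyMeasurable.comp_snd).mul ?_
      exact (hχm.comp ((hpm.comp measurable_snd).sub measurable_fst)).aestronglyMeasurable
    rw [integrable_prod_iff' hm]
    refine ⟨Filter.Eventually.of_forall fun X => ?_, ?_⟩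
    · exact (hχi.comp_sub_left (pos X j)).const_mul (F X)
    · have : (fun X => ∫ y, ‖Φ (y, X)‖) = fun X => ‖F X‖ * V := by
        ext X
        simp only [hΦ, norm_mul, Real.norm_of_nonneg (hχ0 _)]
        rw [integral_const_mul, integral_sub_left_eq_self χ volume (pos X j)]
      rw [this]
      exact hF.norm.mul_const _
  have e1 : ∫ p, Φ p ∂(volume.prod volume) = (∫ X, F X) * V := by
    rw [integral_prod_symm _ hΦi, ← integral_mul_const]
    refine integral_congr_ae (Filter.Eventually.of_forall fun X => ?_)
    simp only [hΦ]
    rw [integral_const_mul, integral_sub_left_eq_self χ volume (pos X j)]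
  have e2 : (fun p : E3 × Config N => Φ (p.1, p.2 + shift j p.1))
      = fun p => F (p.2 + shift j p.1) * χ (pos p.2 j) := by
    ext p
    simp only [hΦ, pos_add_shift_self, add_sub_cancel_right]
  have hΨi := hmp.integrable_comp_of_integrable hΦi
  have e3 : ∫ p : E3 × Config N, Φ (p.1, p.2 + shift j p.1) ∂(volume.prod volume)
      = ∫ p, Φ p ∂(volume.prod volume) := by
    have := integral_map (μ := volume.prod volume) hmp.measurable.aemeasurable
      (f := Φ) (by rw [hmp.map_eq]; exact hΦi.aestronglyMeasurable)
    rw [hmp.map_eq] at this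
    exact this.symm
  have e4 : 0 ≤ ∫ p : E3 × Config N, Φ (p.1, p.2 + shift j p.1) ∂(volume.prod volume) := by
    simp only [Function.comp_def] at hΨi
    rw [e2] at hΨi ⊢
    rw [integral_prod_symm _ hΨi]
    refine integral_nonneg fun X => ?_
    simp only
    rw [integral_mul_const]
    exact mul_nonneg (h X) (hχ0 _)
  rw [e3, e1] at e4
  exact nonneg_of_mul_nonneg_left e4 hVpos

/-- This is why `Isolated` exempts `j`: the indicator is constant while particle `j` moves, and can
be pulled out of the integral over `x_j`. -/
theorem goodInd_congr {ι C : Type*} {c c' : ι → C} {j : ι} (k : ι) (h : ∀ i, i ≠ j → c i = c' i) :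
    goodInd c j k = goodInd c' j k := by
  unfold goodInd
  by_cases hjk : j = k
  · simp [hjk]
  · have : Isolated c j k ↔ Isolated c' j k := by
      unfold Isolated
      refine forall_congr' fun i => ?_
      by_cases hi : i = j
      · simp [hi]
      · rw [h i hi, h k (Ne.symm hjk)]
    by_cases hI : j ≠ k ∧ Isolated c j k
    · rw [if_pos hI, if_pos ⟨hI.1, this.1 hI.2⟩]
    · rw [if_neg hI, if_neg fun h' => hI ⟨h'.1, this.2 h'.2⟩]

theorem measurable_cell_pos (b n : ℝ) (i : Fin N) :
    Measurable fun X : Config N => cell b (n • pos X i) := by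
  refine measurable_pi_lambda _ fun a => ?_
  refine Int.measurable_floor.comp ?_
  have : Continuous fun X : Config N => (n • pos X i) a / (b / √3) := by
    have := continuous_pos i
    fun_prop
  exact this.measurable

theorem measurable_goodInd_cell (b n : ℝ) (j k : Fin N) :
    Measurable fun X : Config N => goodInd (fun i => cell b (n • pos X i)) j k := by
  unfold goodInd
  refine Measurable.ite ?_ measurable_const measurable_const
  by_cases hjk : j = k
  · simp [hjk]
  · simp only [ne_eq, hjk, not_false_eq_true, true_and, Isolated]
    rw [Set.ofPred_forall]
    refine MeasurableSet.iInter fun i => ?_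
    by_cases hi : i ≠ j ∧ i ≠ k
    · have := (measurableSet_eq_fun (measurable_cell_pos b n i) (measurable_cell_pos b n k)).compl
      convert this using 1
      ext X
      simp [hi.1, hi.2]
    · convert MeasurableSet.univ using 1
      ext X
      simp only [Set.mem_ofPred_eq, Set.mem_univ, iff_true]
      intro h1 h2
      exact absurd ⟨h1, h2⟩ hi

/-- The kinetic energy density `|∇_j f|²` of a Schwartz function. -/
noncomputable def gradDens (j : Fin N) (f : 𝓢(Config N, ℂ)) (X : Config N) : ℝ :=
  ∑ a : Fin 3, ‖(∂_{(EuclideanSpace.single (j, a) 1 : Config N)} f) X‖ ^ 2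

theorem gradSq_fiber (f : 𝓢(Config N, ℂ)) (X : Config N) (j : Fin N) (y : E3) :
    gradSq (fun y => f (X + shift j y)) y = gradDens j f (X + shift j y) := by
  have h1 : HasFDerivAt (fun y => X + shift j y) (shift j) y :=
    (shift j).hasFDerivAt.const_add X
  have h2 := (f.hasFDerivAt (X + shift j y)).comp y h1
  rw [gradSq, HasFDerivAt.fderiv (f := fun y => f (X + shift j y)) h2, gradDens]
  refine Finset.sum_congr rfl fun a _ => ?_
  rw [ContinuousLinearMap.comp_apply, shift_single, SchwartzMap.lineDerivOp_apply_eq_fderiv]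

theorem integrable_norm_sq (f : 𝓢(Config N, ℂ)) : Integrable fun X => ‖f X‖ ^ 2 :=
  (f.memLp 2 volume).integrable_norm_pow two_ne_zero

theorem integrable_gradDens (j : Fin N) (f : 𝓢(Config N, ℂ)) : Integrable (gradDens j f) :=
  integrable_finsetSum _ fun _ _ => integrable_norm_sq _

theorem gradDens_nonneg (j : Fin N) (f : 𝓢(Config N, ℂ)) (X : Config N) : 0 ≤ gradDens j f X :=
  Finset.sum_nonneg fun _ _ => by positivity

end Fibers

/-! ### Summing the local inequality over good pairs and counting bad ones -/

section ManyBody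

variable {N : ℕ}

/-- The pair interaction `∑_{j ≠ k} n² u(n |x_j - x_k|)`. -/
noncomputable def pairSum (u : ℝ → ℝ) (n : ℝ) (X : Config N) : ℝ :=
  ∑ j, ∑ k, (if j ≠ k then 1 else 0) * (n ^ 2 * u (n * ‖pos X j - pos X k‖))

theorem measurable_pairTerm {u : ℝ → ℝ} (hu : Measurable u) (n : ℝ) (j k : Fin N) :
    Measurable fun X : Config N => n ^ 2 * u (n * ‖pos X j - pos X k‖) := by
  have : Continuous fun X : Config N => n * ‖pos X j - pos X k‖ :=
    continuous_const.mul ((continuous_pos j).sub (continuous_pos k)).norm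
  exact (hu.comp this.measurable).const_mul _

theorem measurable_pairSum {u : ℝ → ℝ} (hu : Measurable u) (n : ℝ) :
    Measurable (pairSum (N := N) u n) :=
  Finset.measurable_fun_sum _ fun j _ => Finset.measurable_fun_sum _ fun k _ =>
    (measurable_pairTerm hu n j k).const_mul _

theorem abs_pairSum_le {u : ℝ → ℝ} {B : ℝ} (hB : ∀ r, |u r| ≤ B) (n : ℝ) (X : Config N) :
    |pairSum u n X| ≤ N * (N * (n ^ 2 * B)) := by
  have hB0 : 0 ≤ B := (abs_nonneg _).trans (hB 0)
  have h : ∀ j k : Fin N, |(if j ≠ k then 1 else 0) * (n ^ 2 * u (n * ‖pos X j - pos X k‖))|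
      ≤ n ^ 2 * B := by
    intro j k
    have h2 : |n ^ 2 * u (n * ‖pos X j - pos X k‖)| ≤ n ^ 2 * B := by
      rw [abs_mul, abs_of_nonneg (sq_nonneg n)]
      exact mul_le_mul_of_nonneg_left (hB _) (sq_nonneg n)
    split_ifs
    · simpa using h2
    · simpa using mul_nonneg (sq_nonneg n) hB0
  refine (Finset.abs_sum_le_sum_abs _ _).trans ?_
  refine (Finset.sum_le_sum fun j _ => (Finset.abs_sum_le_sum_abs _ _).trans
    (Finset.sum_le_sum fun k _ => h j k)).trans ?_
  simp

theorem integrable_bdd_mul_norm_sq {U : Config N → ℝ} {B : ℝ} (hU : Measurable U)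
    (hB : ∀ X, |U X| ≤ B) (f : 𝓢(Config N, ℂ)) : Integrable fun X => U X * ‖f X‖ ^ 2 :=
  (integrable_norm_sq f).bdd_mul hU.aestronglyMeasurable
    (Filter.Eventually.of_forall fun X => by simpa using hB X)

theorem kineticSq_eq_integral (f : 𝓢(Config N, ℂ)) :
    kineticSq f = ∫ X, ∑ j, gradDens j f X := by
  have h : ∀ g : 𝓢(Config N, ℂ), ‖g.toLp 2 (volume : Measure (Config N))‖ ^ 2
      = ∫ X, ‖g X‖ ^ 2 := by
    intro g
    have h1 := SchwartzMap.inner_toL2_toL2_eq g g (volume : Measure (Config N))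
    have h2 := inner_self_eq_norm_sq (𝕜 := ℂ) (g.toLp 2 (volume : Measure (Config N)))
    rw [h1] at h2
    rw [← h2]
    have h3 : ∀ X, inner ℂ (g X) (g X) = ((‖g X‖ ^ 2 : ℝ) : ℂ) := by
      intro X
      rw [inner_self_eq_norm_sq_to_K]
      simp
    simp only [h3]
    exact (congrArg RCLike.re (integral_ofReal (𝕜 := ℂ) (f := fun X => ‖g X‖ ^ 2))).trans
      (RCLike.ofReal_re _)
  rw [integral_finsetSum _ fun j _ => integrable_gradDens j f, kineticSq, Fintype.sum_prod_type]
  refine Finset.sum_congr rfl fun j _ => ?_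
  simp only [gradDens]
  rw [integral_finsetSum _ fun a _ => integrable_norm_sq _]
  exact Finset.sum_congr rfl fun a _ => h _

open Classical in
/-- The local form inequality for one particle in the field of another, isolated, one. -/
theorem integral_goodInd_nonneg {w : ℝ → ℝ} {b B R n : ℝ} (hn : 0 < n) (hw : Measurable w)
    (hB : ∀ r, |w r| ≤ B)
    (H : ∀ ψ : E3 → ℂ, ContDiff ℝ 1 ψ →
      0 ≤ ∫ x in Metric.ball (0 : E3) R, (gradSq ψ x + w ‖x‖ * ‖ψ x‖ ^ 2))
    (f : 𝓢(Config N, ℂ)) (j k : Fin N) :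
    Integrable (fun X => goodInd (fun i => cell b (n • pos X i)) j k *
      ((if n * ‖pos X j - pos X k‖ < R then 1 else 0) *
        (gradDens j f X + n ^ 2 * w (n * ‖pos X j - pos X k‖) * ‖f X‖ ^ 2))) ∧
    0 ≤ ∫ X, goodInd (fun i => cell b (n • pos X i)) j k *
      ((if n * ‖pos X j - pos X k‖ < R then 1 else 0) *
        (gradDens j f X + n ^ 2 * w (n * ‖pos X j - pos X k‖) * ‖f X‖ ^ 2)) := by
  have hB0 : 0 ≤ B := (abs_nonneg _).trans (hB 0)
  have hi : Integrable (fun X => goodInd (fun i => cell b (n • pos X i)) j k *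
      ((if n * ‖pos X j - pos X k‖ < R then 1 else 0) *
        (gradDens j f X + n ^ 2 * w (n * ‖pos X j - pos X k‖) * ‖f X‖ ^ 2))) := by
    refine Integrable.bdd_mul (c := 1) ?_ (measurable_goodInd_cell b n j k).aestronglyMeasurable ?_
    · refine Integrable.bdd_mul (c := 1) ?_ ?_ ?_
      · refine (integrable_gradDens j f).add
          (integrable_bdd_mul_norm_sq (B := n ^ 2 * B) (measurable_pairTerm hw n j k) ?_ f)
        intro X
        rw [abs_mul, abs_of_nonneg (sq_nonneg n)]
        exact mul_le_mul_of_nonneg_left (hB _) (sq_nonneg n)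
      · refine (Measurable.ite ?_ measurable_const measurable_const).aestronglyMeasurable
        have : Continuous fun X : Config N => n * ‖pos X j - pos X k‖ :=
          continuous_const.mul ((continuous_pos j).sub (continuous_pos k)).norm
        exact measurableSet_lt this.measurable measurable_const
      · refine Filter.Eventually.of_forall fun X => ?_
        split_ifs <;> simp
    · refine Filter.Eventually.of_forall fun X => ?_
      unfold goodInd
      split_ifs <;> simp
  refine ⟨hi, integral_nonneg_of_fibers hi j fun X => ?_⟩
  by_cases hjk : j = k
  · simp [goodInd, hjk]
  have hkj : k ≠ j := Ne.symm hjk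
  have hψ : ContDiff ℝ 1 fun y => f (X + shift j y) :=
    (f.smooth 1).comp (contDiff_const.add (shift j).contDiff)
  -- The variable is the displacement `y` of particle `j`, so particle `k` sits at `x_k - x_j`.
  have h0 := localForm_nonneg_scaled H hn (pos X k - pos X j) hψ
  have hpt : (fun y => goodInd (fun i => cell b (n • pos (X + shift j y) i)) j k *
      ((if n * ‖pos (X + shift j y) j - pos (X + shift j y) k‖ < R then 1 else 0) *
        (gradDens j f (X + shift j y) + n ^ 2 *
          w (n * ‖pos (X + shift j y) j - pos (X + shift j y) k‖) * ‖f (X + shift j y)‖ ^ 2)))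
      = fun y => goodInd (fun i => cell b (n • pos X i)) j k *
        {y : E3 | n * ‖y - (pos X k - pos X j)‖ < R}.indicator (fun y =>
          gradSq (fun y => f (X + shift j y)) y + n ^ 2 * w (n * ‖y - (pos X k - pos X j)‖) *
            ‖f (X + shift j y)‖ ^ 2) y := by
    ext y
    have h1 : pos X j + y - pos X k = y - (pos X k - pos X j) := by abel
    rw [goodInd_congr (c' := fun i => cell b (n • pos X i)) k
      (fun i hi => by rw [pos_add_shift_of_ne X hi y]), pos_add_shift_self,
      pos_add_shift_of_ne X hkj, h1]
    congr 1
    by_cases hR : n * ‖y - (pos X k - pos X j)‖ < R <;> simp [Set.indicator, hR, gradSq_fiber]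
  rw [hpt, integral_const_mul]
  exact mul_nonneg (goodInd_nonneg _ _ _) h0

open Classical in
theorem sum_goodInd_scaled_le {b R n : ℝ} (hb : 0 < b) (hn : 0 < n) (X : Config N) (j : Fin N) :
    ∑ k, goodInd (fun i => cell b (n • pos X i)) j k *
      (if n * ‖pos X j - pos X k‖ < R then 1 else 0) ≤ cubeNumber b R := by
  have h := sum_goodInd_le (R := R) hb (fun i => n • pos X i) j
  simpa only [← smul_sub, norm_smul, Real.norm_of_nonneg hn.le] using h

theorem sum_badInd_scaled_le {b R lam Lam n : ℝ} (hb : 0 < b) (hn : 0 < n) (hLam : 0 < Lam)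
    (hlam : 0 ≤ lam) {vm vp : ℝ → ℝ} (hm : ∀ r, vm r ≤ if r < R then lam else 0)
    (hp0 : ∀ r, 0 ≤ vp r) (hp : ∀ r, r < b → Lam ≤ vp r) (X : Config N) :
    ∑ j, ∑ k, badInd (fun i => cell b (n • pos X i)) j k *
        (n ^ 2 * vm (n * ‖pos X j - pos X k‖))
      ≤ 4 * cubeNumber b R * lam / Lam * pairSum vp n X := by
  have h := sum_badInd_mul_le hb hLam hlam hm hp0 hp (fun i => n • pos X i)
  simp only [← smul_sub, norm_smul, Real.norm_of_nonneg hn.le] at h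
  have h2 := mul_le_mul_of_nonneg_left h (sq_nonneg n)
  refine (le_of_eq ?_).trans (h2.trans (le_of_eq ?_))
  · simp only [Finset.mul_sum]
    refine Finset.sum_congr rfl fun j _ => Finset.sum_congr rfl fun k _ => by ring
  · rw [pairSum]
    simp only [Finset.mul_sum]
    refine Finset.sum_congr rfl fun j _ => Finset.sum_congr rfl fun k _ => ?_
    split_ifs <;> ring

open Classical in
/-- The attraction is controlled by the kinetic energy and the repulsion. -/
theorem kineticSq_add_pair_nonneg {b R B lam Lam q n : ℝ} (hb : 0 < b) (hR : 0 < R) (hn : 0 < n)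
    (hLam : 0 < Lam) (hlam : 0 ≤ lam) (hq : 1 ≤ q) {vm vp : ℝ → ℝ}
    (hvm : Measurable vm) (hvp : Measurable vp) (hmB : ∀ r, |vm r| ≤ B) (hpB : ∀ r, |vp r| ≤ B)
    (hm0 : ∀ r, 0 ≤ vm r) (hm : ∀ r, vm r ≤ if r < R then lam else 0)
    (hp0 : ∀ r, 0 ≤ vp r) (hp : ∀ r, r < b → Lam ≤ vp r)
    (H : ∀ ψ : E3 → ℂ, ContDiff ℝ 1 ψ → 0 ≤ ∫ x in Metric.ball (0 : E3) R,
      (gradSq ψ x + q * cubeNumber b R * (2 * vp ‖x‖ - 4 * vm ‖x‖) * ‖ψ x‖ ^ 2))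
    (f : 𝓢(Config N, ℂ)) :
    0 ≤ kineticSq f + ∫ X, ((2 + 4 * (4 * cubeNumber b R * lam / Lam)) * pairSum vp n X
      - 4 * pairSum vm n X) * ‖f X‖ ^ 2 := by
  set ν : ℝ := (cubeNumber b R : ℝ) with hν
  have hνpos : 0 < ν := Nat.cast_pos.2 (cubeNumber_pos hb hR)
  set κ : ℝ := 4 * ν * lam / Lam with hκ
  set w : ℝ → ℝ := fun r => q * ν * (2 * vp r - 4 * vm r) with hw
  have hwm : Measurable w := ((hvp.const_mul 2).sub (hvm.const_mul 4)).const_mul _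
  have hwB : ∀ r, |w r| ≤ q * ν * (6 * B) := by
    intro r
    simp only [hw]
    rw [abs_mul, abs_of_pos (by positivity : 0 < q * ν)]
    refine mul_le_mul_of_nonneg_left ?_ (by positivity)
    have h1 := abs_le.1 (hmB r)
    have h2 := abs_le.1 (hpB r)
    rw [abs_le]
    constructor <;> linarith [hm0 r, hp0 r]
  have hmR : ∀ r, R ≤ r → vm r = 0 := fun r hr =>
    le_antisymm ((hm r).trans (by rw [if_neg (not_lt.2 hr)])) (hm0 r)
  set G : Config N → Fin N → Fin N → ℝ := fun X j k =>
    goodInd (fun i => cell b (n • pos X i)) j k *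
      ((if n * ‖pos X j - pos X k‖ < R then 1 else 0) *
        (gradDens j f X + n ^ 2 * w (n * ‖pos X j - pos X k‖) * ‖f X‖ ^ 2)) with hG
  have hGI : ∀ j k, Integrable (fun X => G X j k) ∧ 0 ≤ ∫ X, G X j k := fun j k =>
    integral_goodInd_nonneg hn hwm hwB H f j k
  have hsum : 0 ≤ ∫ X, ∑ j, ∑ k, G X j k := by
    rw [integral_finsetSum _ fun j _ => integrable_finsetSum _ fun k _ => (hGI j k).1]
    refine Finset.sum_nonneg fun j _ => ?_
    rw [integral_finsetSum _ fun k _ => (hGI j k).1]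
    exact Finset.sum_nonneg fun k _ => (hGI j k).2
  have hUm : Measurable fun X : Config N =>
      (2 + 4 * κ) * pairSum vp n X - 4 * pairSum vm n X :=
    ((measurable_pairSum hvp n).const_mul _).sub ((measurable_pairSum hvm n).const_mul _)
  have hUi : Integrable fun X => ((2 + 4 * κ) * pairSum vp n X - 4 * pairSum vm n X) * ‖f X‖ ^ 2 := by
    have h1 := (integrable_bdd_mul_norm_sq (measurable_pairSum hvp n) (abs_pairSum_le hpB n) f).const_mul
      (2 + 4 * κ)
    have h2 := (integrable_bdd_mul_norm_sq (measurable_pairSum hvm n) (abs_pairSum_le hmB n) f).const_mul 4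
    refine (h1.sub h2).congr (Filter.Eventually.of_forall fun X => ?_)
    simp only [Pi.sub_apply]
    ring
  have hKi : Integrable fun X => ∑ j, gradDens j f X :=
    integrable_finsetSum _ fun j _ => integrable_gradDens j f
  have hpt : ∀ X, ∑ j, ∑ k, G X j k ≤ ν * q * ((∑ j, gradDens j f X)
      + ((2 + 4 * κ) * pairSum vp n X - 4 * pairSum vm n X) * ‖f X‖ ^ 2) := by
    intro X
    set c : Fin N → (Fin 3 → ℤ) := fun i => cell b (n • pos X i) with hc
    -- The cut-off at `R` is dropped from the potential terms: beyond `R` the attraction vanishes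
    -- and the repulsion only enlarges the right side.
    have e1 : ∀ j k, G X j k ≤ goodInd c j k * (if n * ‖pos X j - pos X k‖ < R then 1 else 0)
        * gradDens j f X + q * ν * ‖f X‖ ^ 2 *
          (2 * (goodInd c j k * (n ^ 2 * vp (n * ‖pos X j - pos X k‖)))
            - 4 * (goodInd c j k * (n ^ 2 * vm (n * ‖pos X j - pos X k‖)))) := by
      intro j k
      simp only [hG, hw]
      by_cases h : n * ‖pos X j - pos X k‖ < R
      · simp only [h, if_true]
        exact le_of_eq (by ring)
      · simp only [h, if_false, hmR _ (not_lt.1 h), zero_mul, mul_zero, zero_add, sub_zero]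
        have h1 := goodInd_nonneg c j k
        have h2 := hp0 (n * ‖pos X j - pos X k‖)
        positivity
    have e2 : ∑ j, ∑ k, G X j k ≤ ∑ j, (∑ k, goodInd c j k *
        (if n * ‖pos X j - pos X k‖ < R then 1 else 0)) * gradDens j f X
        + q * ν * ‖f X‖ ^ 2 *
          (2 * (∑ j, ∑ k, goodInd c j k * (n ^ 2 * vp (n * ‖pos X j - pos X k‖)))
            - 4 * ∑ j, ∑ k, goodInd c j k * (n ^ 2 * vm (n * ‖pos X j - pos X k‖))) := by
      refine (Finset.sum_le_sum fun j _ => Finset.sum_le_sum fun k _ => e1 j k).trans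
        (le_of_eq ?_)
      simp only [Finset.sum_add_distrib, Finset.mul_sum, Finset.sum_mul,
        Finset.sum_sub_distrib, mul_sub]
    have e3 : ∑ j, (∑ k, goodInd c j k * (if n * ‖pos X j - pos X k‖ < R then 1 else 0))
        * gradDens j f X ≤ ν * ∑ j, gradDens j f X := by
      rw [Finset.mul_sum]
      exact Finset.sum_le_sum fun j _ => mul_le_mul_of_nonneg_right
        (sum_goodInd_scaled_le hb hn X j) (gradDens_nonneg j f X)
    have e4 : ∑ j, ∑ k, goodInd c j k * (n ^ 2 * vp (n * ‖pos X j - pos X k‖))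
        ≤ pairSum vp n X := by
      refine Finset.sum_le_sum fun j _ => Finset.sum_le_sum fun k _ => ?_
      have h1 := goodInd_add_badInd c j k
      have h2 := badInd_nonneg c j k
      refine mul_le_mul_of_nonneg_right ?_ (mul_nonneg (sq_nonneg n) (hp0 _))
      split_ifs at h1 ⊢ <;> linarith
    have e5 : pairSum vm n X
        = ∑ j, ∑ k, goodInd c j k * (n ^ 2 * vm (n * ‖pos X j - pos X k‖))
          + ∑ j, ∑ k, badInd c j k * (n ^ 2 * vm (n * ‖pos X j - pos X k‖)) := by
      simp only [pairSum, ← Finset.sum_add_distrib, ← add_mul, goodInd_add_badInd]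
      refine Finset.sum_congr rfl fun j _ => Finset.sum_congr rfl fun k _ => ?_
      split_ifs <;> ring
    have e6 := sum_badInd_scaled_le hb hn hLam hlam hm hp0 hp X
    rw [← hν, ← hκ, ← hc] at e6
    -- Good repulsion is at most all repulsion; good attraction is all attraction minus the bad
    -- part, and the latter is at most `κ` times the repulsion.
    have e7 : 2 * (∑ j, ∑ k, goodInd c j k * (n ^ 2 * vp (n * ‖pos X j - pos X k‖)))
            - 4 * ∑ j, ∑ k, goodInd c j k * (n ^ 2 * vm (n * ‖pos X j - pos X k‖))
        ≤ (2 + 4 * κ) * pairSum vp n X - 4 * pairSum vm n X := by linarith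
    -- Since `q ≥ 1`, enlarging the kinetic term lets the common factor `ν q` be divided out.
    have e8 : ν * ∑ j, gradDens j f X ≤ ν * q * ∑ j, gradDens j f X := by
      have h1 : 0 ≤ ∑ j, gradDens j f X := Finset.sum_nonneg fun j _ => gradDens_nonneg j f X
      refine mul_le_mul_of_nonneg_right ?_ h1
      exact le_mul_of_one_le_right hνpos.le hq
    have e9 := mul_le_mul_of_nonneg_left e7 (by positivity : 0 ≤ q * ν * ‖f X‖ ^ 2)
    linarith
  have h1 : 0 ≤ ∫ X, ν * q * ((∑ j, gradDens j f X)
      + ((2 + 4 * κ) * pairSum vp n X - 4 * pairSum vm n X) * ‖f X‖ ^ 2) :=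
    hsum.trans (integral_mono (integrable_finsetSum _ fun j _ => integrable_finsetSum _ fun k _ =>
      (hGI j k).1) ((hKi.add hUi).const_mul _) hpt)
  rw [integral_const_mul, integral_add hKi hUi, ← kineticSq_eq_integral] at h1
  exact nonneg_of_mul_nonneg_right h1 (by positivity)

end ManyBody

/-! ### Passage to `H²` and permutation symmetry -/

section QuadraticForms

open Filter Topology

variable {N : ℕ}

theorem WaveFn.integrable_norm_sq (Φ : WaveFn N) : Integrable fun X => ‖Φ X‖ ^ 2 :=
  (Lp.memLp Φ).integrable_norm_pow two_ne_zero

theorem WaveFn.norm_sq_eq_integral (Φ : WaveFn N) : ‖Φ‖ ^ 2 = ∫ X, ‖Φ X‖ ^ 2 := by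
  rw [← inner_self_eq_norm_sq (𝕜 := ℂ) Φ, L2.inner_def]
  have h3 : ∀ X, inner ℂ (Φ X) (Φ X) = ((‖Φ X‖ ^ 2 : ℝ) : ℂ) := by
    intro X
    rw [inner_self_eq_norm_sq_to_K]
    simp
  simp only [h3]
  exact (congrArg RCLike.re (integral_ofReal (𝕜 := ℂ) (f := fun X => ‖Φ X‖ ^ 2))).trans
      (RCLike.ofReal_re _)

theorem WaveFn.integrable_mul_norm_sq {U : Config N → ℝ} {B : ℝ}
    (hU : AEStronglyMeasurable U volume) (hB : ∀ᵐ X, |U X| ≤ B) (Φ : WaveFn N) :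
    Integrable fun X => U X * ‖Φ X‖ ^ 2 :=
  Φ.integrable_norm_sq.bdd_mul hU (by simpa using hB)

/-- The quadratic form of a bounded potential is continuous on `L²`. -/
theorem WaveFn.continuous_integral_mul_norm_sq {U : Config N → ℝ} {B : ℝ} (hU : Measurable U)
    (hB : ∀ X, |U X| ≤ B) : Continuous fun Φ : WaveFn N => ∫ X, U X * ‖Φ X‖ ^ 2 := by
  have hm : MemLp (fun X => (U X : ℂ)) ∞ (volume : Measure (Config N)) :=
    memLp_top_of_bound (Complex.measurable_ofReal.comp hU).aestronglyMeasurable B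
      (Eventually.of_forall fun X => by simpa using hB X)
  set M : Lp ℂ ∞ (volume : Measure (Config N)) := hm.toLp with hM
  have hc : Continuous fun Φ : WaveFn N => (M • Φ : WaveFn N) := by
    let T : WaveFn N →+ WaveFn N :=
      { toFun := fun Φ => (M • Φ : WaveFn N)
        map_zero' := Lp.smul_zero ℂ 2 M
        map_add' := fun a b => Lp.add_smul _ _ _ }
    exact AddMonoidHomClass.continuous_of_bound T ‖M‖ fun Φ => Lp.norm_smul_le M Φ
  have he : (fun Φ : WaveFn N => ∫ X, U X * ‖Φ X‖ ^ 2)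
      = fun Φ : WaveFn N => (inner ℂ Φ (M • Φ : WaveFn N)).re := by
    ext Φ
    rw [L2.inner_def]
    have h1 : ∫ X, inner ℂ (Φ X) ((M • Φ : WaveFn N) X)
        = ∫ X, ((U X * ‖Φ X‖ ^ 2 : ℝ) : ℂ) := by
      refine integral_congr_ae ?_
      filter_upwards [Lp.coeFn_lpSMul (r := 2) M Φ, hm.coeFn_toLp] with X h2 h3
      rw [h2, Pi.smul_apply', h3, smul_eq_mul, ← smul_eq_mul, inner_smul_right,
        inner_self_eq_norm_sq_to_K]
      simp
    rw [h1]
    exact ((congrArg Complex.re (integral_ofReal (𝕜 := ℂ) (f := fun X => U X * ‖Φ X‖ ^ 2))).trans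
      (Complex.ofReal_re _)).symm
  rw [he]
  exact Complex.continuous_re.comp (continuous_id.inner hc)

theorem integral_mul_norm_toLp_sq (U : Config N → ℝ) (f : 𝓢(Config N, ℂ)) :
    ∫ X, U X * ‖(f.toLp 2 volume : WaveFn N) X‖ ^ 2 = ∫ X, U X * ‖f X‖ ^ 2 := by
  refine integral_congr_ae ?_
  filter_upwards [f.coeFn_toLp 2 (volume : Measure (Config N))] with X h
  rw [h]

theorem tendsto_kineticSq {Ψ : WaveFn N} {f : ℕ → 𝓢(Config N, ℂ)}
    (h : ∀ j a, Tendsto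
        (fun n => (∂_{(EuclideanSpace.single (j, a) 1 : Config N)} (f n)).toLp 2 volume)
        atTop (𝓝 (partialL2 j a Ψ))) :
    Tendsto (fun n => kineticSq (f n)) atTop (𝓝 (∑ j, gradNormSq j Ψ)) := by
  simp only [kineticSq, gradNormSq]
  rw [← Fintype.sum_prod_type' (f := fun j a => ‖partialL2 j a Ψ‖ ^ 2)]
  exact tendsto_finsetSum _ fun p _ => ((h p.1 p.2).norm).pow 2

theorem MemH2.inner_laplacianL2 {Ψ : WaveFn N} (hΨ : MemH2 Ψ) :
    (inner ℂ Ψ (laplacianL2 Ψ)).re = -∑ j, gradNormSq j Ψ := by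
  obtain ⟨f, h1, h2, h3⟩ := hΨ.exists_schwartz_tendsto
  have h4 := (Complex.continuous_re.tendsto _).comp (h1.inner (𝕜 := ℂ) h3)
  refine tendsto_nhds_unique h4 ((tendsto_kineticSq h2).neg.congr fun n => ?_)
  simp only [Function.comp_apply, inner_toLp_laplacian]
  simp

end QuadraticForms

/-! ### Equal contributions of all particles and all pairs -/

section Symmetry

open Filter Topology

variable {N : ℕ}

/-- The permutation of particles as a linear isometry. -/
noncomputable def permuteIso (σ : Equiv.Perm (Fin N)) : Config N ≃ₗᵢ[ℝ] Config N :=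
  LinearIsometryEquiv.piLpCongrLeft 2 ℝ ℝ (σ.symm.prodCongr (Equiv.refl (Fin 3)))

theorem permuteIso_apply (σ : Equiv.Perm (Fin N)) (X : Config N) :
    permuteIso σ X = permute σ X := by
  ext p
  rfl

theorem measurePreserving_permute (σ : Equiv.Perm (Fin N)) :
    MeasurePreserving (permute (N := N) σ) volume volume := by
  have := (permuteIso σ).measurePreserving
  rwa [show ⇑(permuteIso σ) = permute σ from funext (permuteIso_apply σ)] at this

theorem pos_permute (σ : Equiv.Perm (Fin N)) (X : Config N) (j : Fin N) :
    pos (permute σ X) j = pos X (σ j) := rfl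

theorem permute_single (σ : Equiv.Perm (Fin N)) (j : Fin N) (a : Fin 3) :
    permute σ (EuclideanSpace.single (σ j, a) 1) = EuclideanSpace.single (j, a) 1 := by
  ext ⟨i, b⟩
  by_cases h : i = j <;> by_cases h' : b = a <;> simp [permute, h, h']

theorem IsSymm.integral_pair_eq {Ψ : WaveFn N} (hΨ : IsSymm Ψ) (u : E3 → ℝ)
    (σ : Equiv.Perm (Fin N)) (j k : Fin N) :
    ∫ X, u (pos X (σ j) - pos X (σ k)) * ‖Ψ X‖ ^ 2 = ∫ X, u (pos X j - pos X k) * ‖Ψ X‖ ^ 2 := by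
  have hemb : MeasurableEmbedding (permute (N := N) σ) := by
    have := (permuteIso σ).toHomeomorph.measurableEmbedding
    rwa [show ⇑(permuteIso σ).toHomeomorph = permute σ from funext (permuteIso_apply σ)] at this
  rw [← (measurePreserving_permute σ).integral_comp hemb
    (fun X => u (pos X j - pos X k) * ‖Ψ X‖ ^ 2)]
  refine integral_congr_ae ?_
  filter_upwards [hΨ σ] with X h
  rw [h, pos_permute, pos_permute]

/-- If `f n` are Schwartz functions tending to `Ψ`, so do the permuted `f n`, as `Ψ` is symmetric.
The derivatives of the latter in `x_{σ j}` are the permuted derivatives in `x_j`, and permutation is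
an isometry of `L²`. -/
theorem IsSymm.norm_partialL2_eq {Ψ : WaveFn N} (hΨ : IsSymm Ψ) (h2 : MemH2 Ψ)
    (σ : Equiv.Perm (Fin N)) (j : Fin N) (a : Fin 3) :
    ‖partialL2 (σ j) a Ψ‖ = ‖partialL2 j a Ψ‖ := by
  obtain ⟨f, hf, hd, -⟩ := h2.exists_schwartz_tendsto
  have hmp := measurePreserving_permute (N := N) σ
  set g : Config N ≃L[ℝ] Config N := (permuteIso σ).toContinuousLinearEquiv with hg
  have hgp : ∀ X, g X = permute σ X := permuteIso_apply σ
  set Cσ : 𝓢(Config N, ℂ) →L[ℂ] 𝓢(Config N, ℂ) :=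
    SchwartzMap.compCLMOfContinuousLinearEquiv ℂ g with hC
  have hlp : ∀ s : 𝓢(Config N, ℂ), (Cσ s).toLp 2 volume
      = Lp.compMeasurePreserving (permute σ) hmp (s.toLp 2 volume) := by
    intro s
    refine Lp.ext ?_
    filter_upwards [(Cσ s).coeFn_toLp 2 (volume : Measure (Config N)),
      Lp.coeFn_compMeasurePreserving (s.toLp 2 volume) hmp,
      hmp.quasiMeasurePreserving.ae_eq_comp (s.coeFn_toLp 2 (volume : Measure (Config N)))]
      with X h1 h2 h3
    rw [h1, h2, h3]
    simp [hC, hgp]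
  have hcont : Continuous (Lp.compMeasurePreserving (E := ℂ) (p := 2) (permute (N := N) σ) hmp) :=
    (Lp.isometry_compMeasurePreserving (E := ℂ) (p := 2) hmp).continuous
  have hΨσ : Lp.compMeasurePreserving (permute σ) hmp Ψ = Ψ := by
    refine Lp.ext ?_
    filter_upwards [Lp.coeFn_compMeasurePreserving Ψ hmp, hΨ σ] with X h1 h2
    rw [h1, Function.comp_apply, h2]
  have e1 : Tendsto (fun n => (Cσ (f n)).toLp 2 volume) atTop (𝓝 Ψ) := by
    have := (hcont.tendsto Ψ).comp hf
    rw [hΨσ] at this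
    exact this.congr fun n => (hlp _).symm
  have e2 : Tendsto (fun n =>
      (∂_{(EuclideanSpace.single (σ j, a) 1 : Config N)} (Cσ (f n))).toLp 2 volume) atTop
      (𝓝 (Lp.compMeasurePreserving (permute σ) hmp (partialL2 j a Ψ))) := by
    refine ((hcont.tendsto _).comp (hd j a)).congr fun n => ?_
    rw [Function.comp_apply, ← hlp, hC, SchwartzMap.lineDerivOp_compCLMOfContinuousLinearEquiv,
      hgp, permute_single]
  rw [← eq_partialL2_of_tendsto h2 e1 (σ j) a e2]
  exact Lp.norm_compMeasurePreserving _ hmp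

theorem IsSymm.gradNormSq_eq {Ψ : WaveFn N} (hΨ : IsSymm Ψ) (h2 : MemH2 Ψ) (i j : Fin N) :
    gradNormSq j Ψ = gradNormSq i Ψ := by
  refine Finset.sum_congr rfl fun a _ => ?_
  have := hΨ.norm_partialL2_eq h2 (Equiv.swap i j) i a
  rw [Equiv.swap_apply_left] at this
  rw [this]

theorem IsSymm.sum_gradNormSq {Ψ : WaveFn N} (hΨ : IsSymm Ψ) (h2 : MemH2 Ψ) (i : Fin N) :
    ∑ j, gradNormSq j Ψ = N * gradNormSq i Ψ := by
  rw [Finset.sum_congr rfl fun j _ => hΨ.gradNormSq_eq h2 i j]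
  simp

theorem exists_perm_apply_pair {α : Type*} [DecidableEq α] {a b c d : α} (hab : a ≠ b)
    (hcd : c ≠ d) : ∃ σ : Equiv.Perm α, σ a = c ∧ σ b = d := by
  refine ⟨(Equiv.swap a c).trans (Equiv.swap (Equiv.swap a c b) d), ?_, ?_⟩
  · have h1 : c ≠ Equiv.swap a c b := by
      intro h
      apply hab
      exact (Equiv.swap a c).injective ((Equiv.swap_apply_left a c).trans h)
    rw [Equiv.trans_apply, Equiv.swap_apply_left, Equiv.swap_apply_of_ne_of_ne h1 hcd]
  · rw [Equiv.trans_apply, Equiv.swap_apply_left]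

/-- For a symmetric wave function all pairs contribute equally to the interaction energy. -/
theorem IsSymm.integral_pairSum {Ψ : WaveFn N} (hΨ : IsSymm Ψ) {u : ℝ → ℝ} {B : ℝ}
    (hu : Measurable u) (hB : ∀ r, |u r| ≤ B) (n : ℝ) {i k : Fin N} (hik : i ≠ k) :
    ∫ X, pairSum u n X * ‖Ψ X‖ ^ 2
      = N * (N - 1) * ∫ X, n ^ 2 * u (n * ‖pos X i - pos X k‖) * ‖Ψ X‖ ^ 2 := by
  set I := ∫ X, n ^ 2 * u (n * ‖pos X i - pos X k‖) * ‖Ψ X‖ ^ 2 with hI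
  have hint : ∀ j l : Fin N, Integrable fun X : Config N =>
      (if j ≠ l then 1 else 0) * (n ^ 2 * u (n * ‖pos X j - pos X l‖) * ‖Ψ X‖ ^ 2) := by
    intro j l
    refine Integrable.const_mul ?_ _
    refine Ψ.integrable_mul_norm_sq (measurable_pairTerm hu n j l).aestronglyMeasurable
      (B := n ^ 2 * B) (Eventually.of_forall fun X => ?_)
    rw [abs_mul, abs_of_nonneg (sq_nonneg n)]
    exact mul_le_mul_of_nonneg_left (hB _) (sq_nonneg n)
  have h1 : ∀ j l : Fin N, ∫ X : Config N,
      (if j ≠ l then 1 else 0) * (n ^ 2 * u (n * ‖pos X j - pos X l‖) * ‖Ψ X‖ ^ 2)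
      = (if j ≠ l then 1 else 0) * I := by
    intro j l
    rw [integral_const_mul]
    by_cases hjl : j = l
    · simp [hjl]
    · obtain ⟨σ, rfl, rfl⟩ := exists_perm_apply_pair hik hjl
      rw [hI, hΨ.integral_pair_eq (fun x => n ^ 2 * u (n * ‖x‖)) σ i k]
  have h2 : (fun X => pairSum u n X * ‖Ψ X‖ ^ 2) = fun X => ∑ j, ∑ l,
      (if j ≠ l then 1 else 0) * (n ^ 2 * u (n * ‖pos X j - pos X l‖) * ‖Ψ X‖ ^ 2) := by
    ext X
    simp only [pairSum, Finset.sum_mul, mul_assoc]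
  rw [h2, integral_finsetSum _ fun j _ => integrable_finsetSum _ fun l _ => hint j l]
  have h3 : ∀ j : Fin N, ∑ l, (if j ≠ l then (1 : ℝ) else 0) = N - 1 := by
    intro j
    have : ∀ l, (if j ≠ l then (1 : ℝ) else 0) = 1 - if j = l then 1 else 0 := by
      intro l
      by_cases h : j = l <;> simp [h]
    simp [this]
  calc _ = ∑ j : Fin N, ∑ l, (if j ≠ l then 1 else 0) * I := by
        refine Finset.sum_congr rfl fun j _ => ?_
        rw [integral_finsetSum _ fun l _ => hint j l]
        exact Finset.sum_congr rfl fun l _ => h1 j l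
    _ = _ := by
        simp only [← Finset.sum_mul, h3, Finset.sum_const, Finset.card_univ, Fintype.card_fin,
          nsmul_eq_mul]

end Symmetry

/-! ### Radial profiles of admissible potentials -/

theorem cubeNumber_mono {b : ℝ} (hb : 0 < b) {ρ ρ' : ℝ} (h : ρ ≤ ρ') :
    cubeNumber b ρ ≤ cubeNumber b ρ' := by
  refine ciSup_mono (cubeNumber_wellDefined hb ρ').2 fun x => ?_
  refine Set.ncard_le_ncard ?_ ((cubeNumber_wellDefined hb ρ').1 x)
  rintro m ⟨y, hy, hyx⟩
  exact ⟨y, hy, Metric.ball_subset_ball h hyx⟩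

theorem vPlus_sub_vMinus (V : E3 → ℝ) (x : E3) : vPlus V x - vMinus V x = V x := by
  unfold vPlus vMinus
  rcases le_total (V x) 0 with h | h
  · rw [max_eq_right h, max_eq_left (by linarith)]; ring
  · rw [max_eq_left h, max_eq_right (by linarith)]; ring

/-- The positive and negative parts of an admissible potential have bounded radial representatives
for which the defining inequalities hold pointwise. -/
theorem IsAdmissibleWith.exists_profile {V : E3 → ℝ} {r₁ r₂ R lamPlus : ℝ}
    (h : IsAdmissibleWith V r₁ r₂ R lamPlus) :
    ∃ (vp vm : ℝ → ℝ) (B : ℝ), Measurable vp ∧ Measurable vm ∧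
      (∀ r, 0 ≤ vp r ∧ vp r ≤ B) ∧ (∀ r, 0 ≤ vm r ∧ vm r ≤ B) ∧
      (∀ r, vm r ≤ if r < R then (eLpNorm (vMinus V) ∞ volume).toReal else 0) ∧
      (∀ r, r < r₁ → lamPlus ≤ vp r) ∧
      (∀ᵐ x : E3, vPlus V x = vp ‖x‖) ∧ (∀ᵐ x : E3, vMinus V x = vm ‖x‖) := by
  obtain ⟨v, hv, hVv⟩ := h.spherical
  set lam : ℝ := (eLpNorm (vMinus V) ∞ volume).toReal with hlam
  set D : ℝ := (eLpNorm V ∞ volume).toReal with hD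
  have hlam0 : 0 ≤ lam := ENNReal.toReal_nonneg
  have hD0 : 0 ≤ D := ENNReal.toReal_nonneg
  have hL := h.lamPlus_pos
  have hVD : ∀ᵐ x : E3, |V x| ≤ D := by
    filter_upwards [ae_le_eLpNormEssSup (f := V) (μ := volume)] with x hx
    rw [← eLpNorm_exponent_top] at hx
    rw [← Real.norm_eq_abs, ← toReal_enorm]
    exact ENNReal.toReal_mono h.memLp_top.2.ne hx
  have hmlt : eLpNorm (vMinus V) ∞ volume ≠ ∞ := by
    refine ((eLpNorm_mono (g := V) fun x => ?_).trans_lt h.memLp_top.2).ne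
    simp only [vMinus, Real.norm_eq_abs]
    rw [abs_of_nonneg (le_max_right _ _)]
    exact max_le (neg_le_abs _) (abs_nonneg _)
  have hmle : ∀ᵐ x : E3, vMinus V x ≤ lam := by
    filter_upwards [ae_le_eLpNormEssSup (f := vMinus V) (μ := volume)] with x hx
    rw [← eLpNorm_exponent_top] at hx
    refine (le_abs_self _).trans ?_
    rw [← Real.norm_eq_abs, ← toReal_enorm]
    exact ENNReal.toReal_mono hmlt hx
  have hmz : ∀ᵐ x : E3, R ≤ ‖x‖ → vMinus V x = 0 := by
    filter_upwards [h.support_minus.mem_iff] with x hx hR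
    by_contra hne
    have h1 := mem_ball_zero_iff.1 (hx.1 hne).1
    linarith
  -- The truncations change the composed functions of `x` only on null sets, but make the bounds
  -- hold at every radius. The counting argument needs this, being pointwise in the configuration.
  refine ⟨fun r => max (min (max (v r) 0) D) (if r < r₁ then lamPlus else 0),
    fun r => if r < R then min (max (-v r) 0) lam else 0, max D (max lamPlus lam),
    ?_, ?_, ?_, ?_, ?_, ?_, ?_, ?_⟩
  · exact ((hv.max measurable_const).min measurable_const).max
      (Measurable.ite measurableSet_Iio measurable_const measurable_const)
  · exact Measurable.ite measurableSet_Iio ((hv.neg.max measurable_const).min measurable_const)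
      measurable_const
  · intro r
    refine ⟨le_max_of_le_left (le_min (le_max_right _ _) hD0), max_le ?_ ?_⟩
    · exact (min_le_right _ _).trans (le_max_left _ _)
    · refine le_max_of_le_right (le_max_of_le_left ?_)
      split_ifs
      · exact le_rfl
      · exact hL.le
  · intro r
    beta_reduce
    split_ifs
    · exact ⟨le_min (le_max_right _ _) hlam0,
        (min_le_right _ _).trans (le_max_of_le_right (le_max_right _ _))⟩
    · exact ⟨le_rfl, le_max_of_le_left hD0⟩
  · intro r
    beta_reduce
    split_ifs
    · exact min_le_right _ _
    · exact le_rfl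
  · intro r hr
    simp [hr]
  · filter_upwards [hVv, hVD, h.core] with x h1 h2 h3
    have h4 : vPlus V x ≤ D := max_le ((le_abs_self _).trans h2) hD0
    have h5 : (if ‖x‖ < r₁ then lamPlus else 0) ≤ vPlus V x := by
      split_ifs with hx
      · exact h3 (by simpa using hx)
      · exact le_max_right _ _
    simp only [← h1]
    change _ = max (min (vPlus V x) D) _
    rw [min_eq_left h4, max_eq_left h5]
  · filter_upwards [hVv, hmle, hmz] with x h1 h2 h3
    simp only [← h1]
    change _ = if ‖x‖ < R then min (vMinus V x) lam else 0
    split_ifs with hx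
    · rw [min_eq_left h2]
    · exact h3 (not_lt.1 hx)

/-! ### The energy form -/

section Energy

open Filter Topology

variable {N : ℕ}

/-- The image of Lebesgue measure is a multiple (possibly infinite) of Lebesgue measure.
Almost-everywhere statements on `ℝ³` therefore hold almost everywhere for positions and for
differences of distinct positions. -/
theorem quasiMeasurePreserving_of_surjective (L : Config N →ₗ[ℝ] E3)
    (hL : Function.Surjective L) :
    Measure.QuasiMeasurePreserving L (volume : Measure (Config N)) (volume : Measure E3) := by
  refine ⟨L.continuous_of_finiteDimensional.measurable, ?_⟩
  obtain ⟨c, -, hc⟩ := L.exists_map_addHaar_eq_smul_addHaar (volume : Measure (Config N))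
    (volume : Measure E3) hL
  rw [hc]
  exact Measure.smul_absolutelyContinuous

/-- The position of the `j`-th particle as a linear map. -/
def posLinear (j : Fin N) : Config N →ₗ[ℝ] E3 where
  toFun X := pos X j
  map_add' _ _ := rfl
  map_smul' _ _ := rfl

theorem posLinear_shift_self (j : Fin N) (y : E3) : posLinear j (shift j y) = y := by
  ext a
  simp [posLinear, pos, shift_apply]

theorem posLinear_shift_of_ne {j k : Fin N} (h : k ≠ j) (y : E3) :
    posLinear k (shift j y) = 0 := by
  ext a
  simp [posLinear, pos, shift_apply, h]

theorem quasiMeasurePreserving_pos (j : Fin N) :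
    Measure.QuasiMeasurePreserving (fun X : Config N => pos X j) volume volume :=
  quasiMeasurePreserving_of_surjective (posLinear j) fun y => ⟨_, posLinear_shift_self j y⟩

theorem quasiMeasurePreserving_smul_pos_sub {j k : Fin N} (hjk : j ≠ k) {n : ℝ} (hn : n ≠ 0) :
    Measure.QuasiMeasurePreserving (fun X : Config N => n • (pos X j - pos X k)) volume volume :=
  quasiMeasurePreserving_of_surjective (n • (posLinear j - posLinear k)) fun y =>
    ⟨shift j (n⁻¹ • y), by
      rw [LinearMap.smul_apply, LinearMap.sub_apply, posLinear_shift_self,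
        posLinear_shift_of_ne hjk.symm, sub_zero, smul_inv_smul₀ hn]⟩

theorem sum_Ioi_eq_half_sum_ne (s : Fin N → Fin N → ℝ) (hs : ∀ j k, s j k = s k j) :
    ∑ j, ∑ k ∈ Finset.Ioi j, s j k = 1 / 2 * ∑ j, ∑ k, (if j ≠ k then 1 else 0) * s j k := by
  have h1 : ∀ j, ∑ k ∈ Finset.Ioi j, s j k = ∑ k, if j < k then s j k else 0 := by
    intro j
    rw [← Finset.sum_filter]
    congr 1
    ext k
    simp
  have h2 : ∀ j k, (if j ≠ k then 1 else 0) * s j k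
      = (if j < k then s j k else 0) + (if k < j then s k j else 0) := by
    intro j k
    rcases lt_trichotomy j k with h | h | h
    · simp [h, h.ne, h.not_gt]
    · simp [h]
    · simp [h, h.ne', h.not_gt, hs j k]
  simp only [h1, h2, Finset.sum_add_distrib]
  rw [Finset.sum_comm (f := fun j k => if k < j then s k j else 0)]
  ring

/-- The interaction energy in terms of the radial profiles of the positive and negative parts. -/
theorem sum_scaledPot_ae_eq {V : E3 → ℝ} {vp vm : ℝ → ℝ} (hp : ∀ᵐ x : E3, vPlus V x = vp ‖x‖)
    (hm : ∀ᵐ x : E3, vMinus V x = vm ‖x‖) (hN : 0 < N) :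
    ∀ᵐ X : Config N, ∑ j : Fin N, ∑ k ∈ Finset.Ioi j, scaledPot N V (pos X j - pos X k)
      = 1 / 2 * (pairSum vp N X - pairSum vm N X) := by
  have hn : (N : ℝ) ≠ 0 := by positivity
  have hV : ∀ᵐ x : E3, V x = vp ‖x‖ - vm ‖x‖ := by
    filter_upwards [hp, hm] with x h1 h2
    rw [← h1, ← h2, vPlus_sub_vMinus]
  have hae : ∀ᵐ X : Config N, ∀ j k : Fin N, j ≠ k →
      scaledPot N V (pos X j - pos X k) = (N : ℝ) ^ 2 * vp (N * ‖pos X j - pos X k‖)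
        - (N : ℝ) ^ 2 * vm (N * ‖pos X j - pos X k‖) := by
    rw [ae_all_iff]
    intro j
    rw [ae_all_iff]
    intro k
    by_cases hjk : j = k
    · simp [hjk]
    · filter_upwards [(quasiMeasurePreserving_smul_pos_sub hjk hn).ae hV] with X hX _
      rw [scaledPot, hX, norm_smul, Real.norm_of_nonneg (Nat.cast_nonneg N)]
      ring
  filter_upwards [hae] with X hX
  set s : Fin N → Fin N → ℝ := fun j k => (N : ℝ) ^ 2 * vp (N * ‖pos X j - pos X k‖)
        - (N : ℝ) ^ 2 * vm (N * ‖pos X j - pos X k‖) with hs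
  have h1 : ∑ j : Fin N, ∑ k ∈ Finset.Ioi j, scaledPot N V (pos X j - pos X k)
      = ∑ j : Fin N, ∑ k ∈ Finset.Ioi j, s j k :=
    Finset.sum_congr rfl fun j _ => Finset.sum_congr rfl fun k hk =>
      hX j k (Finset.mem_Ioi.1 hk).ne
  rw [h1, sum_Ioi_eq_half_sum_ne s fun j k => by simp only [hs, norm_sub_rev]]
  simp only [hs, mul_sub, Finset.sum_sub_distrib, pairSum]

/-- The energy form, split into kinetic, interaction and external parts. -/
theorem energyForm_eq {V A : E3 → ℝ} {vp vm : ℝ → ℝ} {B : ℝ} {K : ℝ≥0} (hvp : Measurable vp)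
    (hvm : Measurable vm) (hpB : ∀ r, |vp r| ≤ B) (hmB : ∀ r, |vm r| ≤ B)
    (hp : ∀ᵐ x : E3, vPlus V x = vp ‖x‖) (hm : ∀ᵐ x : E3, vMinus V x = vm ‖x‖)
    (hA : MemLp A ∞ volume) (hAK : eLpNorm A ∞ volume ≤ (K : ℝ≥0∞)) (hN : 0 < N)
    {Ψ : WaveFn N} (hΨ : MemH2 Ψ) (h1 : ‖Ψ‖ = 1) :
    ∃ α : ℝ, |α| ≤ K * N ∧ energyForm V A Ψ = ∑ j, gradNormSq j Ψ
      + 1 / 2 * ((∫ X, pairSum vp N X * ‖Ψ X‖ ^ 2) - ∫ X, pairSum vm N X * ‖Ψ X‖ ^ 2) + α := by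
  have hAae : ∀ᵐ x : E3, |A x| ≤ K := by
    filter_upwards [ae_le_eLpNormEssSup (f := A) (μ := volume)] with x hx
    rw [← eLpNorm_exponent_top] at hx
    rw [← Real.norm_eq_abs, ← toReal_enorm]
    exact ENNReal.toReal_mono ENNReal.coe_ne_top (hx.trans hAK)
  set S : Config N → ℝ := fun X => ∑ j : Fin N, A (pos X j) with hS
  have hSm : AEStronglyMeasurable S volume :=
    Finset.aestronglyMeasurable_fun_sum _ fun j _ =>
      hA.aestronglyMeasurable.comp_quasiMeasurePreserving (quasiMeasurePreserving_pos j)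
  have hSB : ∀ᵐ X, |S X| ≤ K * N := by
    have : ∀ᵐ X : Config N, ∀ j : Fin N, |A (pos X j)| ≤ K :=
      ae_all_iff.2 fun j => (quasiMeasurePreserving_pos j).ae hAae
    filter_upwards [this] with X hX
    refine (Finset.abs_sum_le_sum_abs _ _).trans ((Finset.sum_le_sum fun j _ => hX j).trans ?_)
    simp [mul_comm]
  have hSi := Ψ.integrable_mul_norm_sq hSm hSB
  have hpi := Ψ.integrable_mul_norm_sq (measurable_pairSum hvp N).aestronglyMeasurable
    (Eventually.of_forall (abs_pairSum_le hpB N))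
  have hmi := Ψ.integrable_mul_norm_sq (measurable_pairSum hvm N).aestronglyMeasurable
    (Eventually.of_forall (abs_pairSum_le hmB N))
  refine ⟨∫ X, S X * ‖Ψ X‖ ^ 2, ?_, ?_⟩
  · refine (abs_integral_le_integral_abs).trans ?_
    have h2 : ∫ X, |S X * ‖Ψ X‖ ^ 2| ≤ ∫ X, K * N * ‖Ψ X‖ ^ 2 := by
      refine integral_mono_ae hSi.abs (Ψ.integrable_norm_sq.const_mul _) ?_
      filter_upwards [hSB] with X hX
      rw [abs_mul, abs_of_nonneg (sq_nonneg ‖Ψ X‖)]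
      exact mul_le_mul_of_nonneg_right hX (sq_nonneg _)
    refine h2.trans (le_of_eq ?_)
    rw [integral_const_mul, ← Ψ.norm_sq_eq_integral, h1]
    ring
  · set W : Config N → ℝ := fun X => 1 / 2 * (pairSum vp N X * ‖Ψ X‖ ^ 2
      - pairSum vm N X * ‖Ψ X‖ ^ 2) + S X * ‖Ψ X‖ ^ 2 with hW
    have hDi : Integrable fun X => 1 / 2 * (pairSum vp N X * ‖Ψ X‖ ^ 2
        - pairSum vm N X * ‖Ψ X‖ ^ 2) := (hpi.sub hmi).const_mul (1 / 2)
    have hWi : Integrable W := hDi.add hSi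
    have hLi : Integrable fun X => inner ℂ (Ψ X) (laplacianL2 Ψ X) :=
      L2.integrable_inner Ψ (laplacianL2 Ψ)
    have hpt : (fun X => conj (Ψ X) * hamiltonian V A Ψ X)
        =ᵐ[volume] fun X => -inner ℂ (Ψ X) (laplacianL2 Ψ X) + ((W X : ℝ) : ℂ) := by
      filter_upwards [sum_scaledPot_ae_eq hp hm hN] with X hX
      have h2 : conj (Ψ X) * Ψ X = ((‖Ψ X‖ ^ 2 : ℝ) : ℂ) := by
        rw [Complex.conj_mul']
        push_cast
        rfl
      simp only [hamiltonian]
      rw [hX]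
      simp only [hW, hS]
      rw [RCLike.inner_apply']
      push_cast at h2 ⊢
      linear_combination ((1 / 2 * ((pairSum vp N X : ℝ) - pairSum vm N X : ℂ))
        + ∑ j : Fin N, (A (pos X j) : ℂ)) * h2
    have hLn : Integrable fun X => -inner ℂ (Ψ X) (laplacianL2 Ψ X) := hLi.neg
    have hWc : Integrable fun X => ((W X : ℝ) : ℂ) := hWi.ofReal
    have h4 : ∫ X, ((W X : ℝ) : ℂ) = ((∫ X, W X : ℝ) : ℂ) := integral_ofReal
    have h3 : ∫ X, W X = 1 / 2 * ((∫ X, pairSum vp N X * ‖Ψ X‖ ^ 2)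
        - ∫ X, pairSum vm N X * ‖Ψ X‖ ^ 2) + ∫ X, S X * ‖Ψ X‖ ^ 2 := by
      simp only [hW]
      rw [integral_add hDi hSi, integral_const_mul,
        integral_sub hpi hmi]
    rw [energyForm, integral_congr_ae hpt, integral_add hLn hWc, integral_neg,
      Complex.add_re, Complex.neg_re, ← L2.inner_def, hΨ.inner_laplacianL2, neg_neg,
      h4, h3, Complex.ofReal_re]
    ring

end Energy

/-! ### The form bound on `H²` and the final constants -/

section Main

open Filter Topology

variable {N : ℕ}

/-- The form inequality for admissible potentials on `H²`, together with the constants. -/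
theorem IsAdmissibleWith.exists_form_bound {V : E3 → ℝ} {r₁ r₂ R lamPlus : ℝ}
    (h : IsAdmissibleWith V r₁ r₂ R lamPlus) :
    ∃ (vp vm : ℝ → ℝ) (B κ : ℝ), Measurable vp ∧ Measurable vm ∧
      (∀ r, 0 ≤ vp r ∧ vp r ≤ B) ∧ (∀ r, 0 ≤ vm r ∧ vm r ≤ B) ∧
      (∀ᵐ x : E3, vPlus V x = vp ‖x‖) ∧ (∀ᵐ x : E3, vMinus V x = vm ‖x‖) ∧ κ < 1 / 2 ∧
      ∀ (N : ℕ) (Ψ : WaveFn N), 0 < N → MemH2 Ψ →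
        4 * ∫ X, pairSum vm N X * ‖Ψ X‖ ^ 2
          ≤ (∑ j, gradNormSq j Ψ) + (2 + 4 * κ) * ∫ X, pairSum vp N X * ‖Ψ X‖ ^ 2 := by
  obtain ⟨vp, vm, B, hvp, hvm, hpB, hmB, hml, hpL, hp, hm⟩ := h.exists_profile
  obtain ⟨ε, hε0, hε1, hloc⟩ := h.localEnergy_nonneg
  set lam : ℝ := (eLpNorm (vMinus V) ∞ volume).toReal with hlam
  have hlam0 : 0 ≤ lam := ENNReal.toReal_nonneg
  have hR : 0 < R := h.r₂_pos.trans h.r₂_lt_R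
  have hL := h.lamPlus_pos
  have hr₁ := h.r₁_pos
  have hpB' : ∀ r, |vp r| ≤ B := fun r => by rw [abs_of_nonneg (hpB r).1]; exact (hpB r).2
  have hmB' : ∀ r, |vm r| ≤ B := fun r => by rw [abs_of_nonneg (hmB r).1]; exact (hmB r).2
  set q : ℝ := 1 / (1 - ε) with hq
  have hq1 : 1 ≤ q := by
    rw [hq, le_div_iff₀ (by linarith)]
    linarith
  set w : ℝ → ℝ := fun r => q * cubeNumber r₁ R * (2 * vp r - 4 * vm r) with hw
  have hwm : Measurable w := ((hvp.const_mul 2).sub (hvm.const_mul 4)).const_mul _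
  have hwB : ∀ r, |w r| ≤ q * cubeNumber r₁ R * (6 * B) := by
    intro r
    simp only [hw]
    rw [abs_mul, abs_of_nonneg (by positivity : 0 ≤ q * cubeNumber r₁ R)]
    refine mul_le_mul_of_nonneg_left ?_ (by positivity)
    have h1 := hpB r
    have h2 := hmB r
    rw [abs_le]
    constructor <;> linarith
  have hform : ∀ ψ : E3 → ℂ, ContDiff ℝ 1 ψ →
      0 ≤ ∫ x in Metric.ball (0 : E3) R, (gradSq ψ x + w ‖x‖ * ‖ψ x‖ ^ 2) := by
    intro ψ hψ
    refine localForm_nonneg hwm hwB (fun φ hφ h1 => ?_) hψ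
    refine (hloc φ hφ h1).trans (le_of_eq ?_)
    rw [localEnergy]
    refine integral_congr_ae (ae_restrict_of_ae ?_)
    filter_upwards [hp, hm] with x h2 h3
    rw [h2, h3]
  set κ : ℝ := 4 * cubeNumber r₁ R * lam / lamPlus with hκ
  refine ⟨vp, vm, B, κ, hvp, hvm, hpB, hmB, hp, hm, ?_, fun N Ψ hN hΨ => ?_⟩
  -- The assumption involves `n(r₁, 3R)`; its consequence for the smaller number `n(r₁, R)` gives `κ
  -- < 1/2`.
  · have h1 : (cubeNumber r₁ R : ℝ) ≤ cubeNumber r₁ (3 * R) := by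
      exact_mod_cast cubeNumber_mono hr₁ (by linarith)
    have h2 := h.lamPlus_gt
    have h3 := mul_le_mul_of_nonneg_right h1 hlam0
    rw [hκ, div_lt_iff₀ hL]
    linarith
  · have hNpos : (0 : ℝ) < N := by exact_mod_cast hN
    obtain ⟨f, hf, hd, -⟩ := hΨ.exists_schwartz_tendsto
    have hcp := WaveFn.continuous_integral_mul_norm_sq (N := N) (measurable_pairSum hvp N)
      (abs_pairSum_le hpB' N)
    have hcm := WaveFn.continuous_integral_mul_norm_sq (N := N) (measurable_pairSum hvm N)
      (abs_pairSum_le hmB' N)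
    refine le_of_tendsto_of_tendsto' (((hcm.tendsto Ψ).comp hf).const_mul 4)
      ((tendsto_kineticSq hd).add (((hcp.tendsto Ψ).comp hf).const_mul (2 + 4 * κ))) fun n => ?_
    have h1 := kineticSq_add_pair_nonneg hr₁ hR hNpos hL hlam0 hq1 hvm hvp hmB' hpB'
      (fun r => (hmB r).1) hml (fun r => (hpB r).1) hpL hform (f n)
    rw [← hκ] at h1
    simp only [Function.comp_apply, integral_mul_norm_toLp_sq]
    have hpi := integrable_bdd_mul_norm_sq (measurable_pairSum hvp N) (abs_pairSum_le hpB' N) (f n)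
    have hmi := integrable_bdd_mul_norm_sq (measurable_pairSum hvm N) (abs_pairSum_le hmB' N) (f n)
    have h2 : ∫ X, ((2 + 4 * κ) * pairSum vp N X - 4 * pairSum vm N X) * ‖f n X‖ ^ 2
        = (2 + 4 * κ) * (∫ X, pairSum vp N X * ‖f n X‖ ^ 2)
          - 4 * ∫ X, pairSum vm N X * ‖f n X‖ ^ 2 := by
      rw [← integral_const_mul, ← integral_const_mul,
        ← integral_sub (hpi.const_mul _) (hmi.const_mul _)]
      refine integral_congr_ae (Eventually.of_forall fun X => ?_)
      simp only
      ring
    rw [h2] at h1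
    linarith

/-- The square of the pair potential is controlled by the interaction energies. -/
theorem pairPotNormSq_le {V : E3 → ℝ} {vp vm : ℝ → ℝ} {B : ℝ} (hvp : Measurable vp)
    (hvm : Measurable vm) (hpB : ∀ r, 0 ≤ vp r ∧ vp r ≤ B) (hmB : ∀ r, 0 ≤ vm r ∧ vm r ≤ B)
    (hp : ∀ᵐ x : E3, vPlus V x = vp ‖x‖) (hm : ∀ᵐ x : E3, vMinus V x = vm ‖x‖)
    {Ψ : WaveFn N} (hΨ : IsSymm Ψ) (hN : 3 ≤ N) {i k : Fin N} (hik : i ≠ k) :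
    pairPotNormSq V i k Ψ ≤ 3 / 2 * B * ((∫ X, pairSum vp N X * ‖Ψ X‖ ^ 2)
      + ∫ X, pairSum vm N X * ‖Ψ X‖ ^ 2) := by
  have hpB' : ∀ r, |vp r| ≤ B := fun r => by rw [abs_of_nonneg (hpB r).1]; exact (hpB r).2
  have hmB' : ∀ r, |vm r| ≤ B := fun r => by rw [abs_of_nonneg (hmB r).1]; exact (hmB r).2
  have hB0 : 0 ≤ B := (hpB 0).1.trans (hpB 0).2
  have hN3 : (3 : ℝ) ≤ N := by exact_mod_cast hN
  have hn : (N : ℝ) ≠ 0 := by positivity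
  have hint : ∀ u : ℝ → ℝ, Measurable u → (∀ r, |u r| ≤ B) → Integrable fun X : Config N =>
      (N : ℝ) ^ 2 * u (N * ‖pos X i - pos X k‖) * ‖Ψ X‖ ^ 2 := by
    intro u hu hB
    refine Ψ.integrable_mul_norm_sq (measurable_pairTerm hu N i k).aestronglyMeasurable
      (B := (N : ℝ) ^ 2 * B) (Eventually.of_forall fun X => ?_)
    rw [abs_mul, abs_of_nonneg (sq_nonneg (N : ℝ))]
    exact mul_le_mul_of_nonneg_left (hB _) (sq_nonneg _)
  set Ip := ∫ X, (N : ℝ) ^ 2 * vp (N * ‖pos X i - pos X k‖) * ‖Ψ X‖ ^ 2 with hIp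
  set Im := ∫ X, (N : ℝ) ^ 2 * vm (N * ‖pos X i - pos X k‖) * ‖Ψ X‖ ^ 2 with hIm
  have hIp0 : 0 ≤ Ip := integral_nonneg fun X => by
    have := (hpB (N * ‖pos X i - pos X k‖)).1
    positivity
  have hIm0 : 0 ≤ Im := integral_nonneg fun X => by
    have := (hmB (N * ‖pos X i - pos X k‖)).1
    positivity
  have hV : ∀ᵐ x : E3, V x = vp ‖x‖ - vm ‖x‖ := by
    filter_upwards [hp, hm] with x h1 h2
    rw [← h1, ← h2, vPlus_sub_vMinus]
  have hle : pairPotNormSq V i k Ψ ≤ (N : ℝ) ^ 2 * B * (Ip + Im) := by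
    rw [pairPotNormSq, hIp, hIm, ← integral_add (hint vp hvp hpB') (hint vm hvm hmB'),
      ← integral_const_mul]
    refine integral_mono_of_nonneg (Eventually.of_forall fun X => by positivity)
      (((hint vp hvp hpB').add (hint vm hvm hmB')).const_mul _) ?_
    filter_upwards [(quasiMeasurePreserving_smul_pos_sub hik hn).ae hV] with X hX
    rw [norm_mul, mul_pow, Complex.norm_real, Real.norm_eq_abs, sq_abs, scaledPot, hX, norm_smul,
      Real.norm_of_nonneg (Nat.cast_nonneg N)]
    have h1 := hpB (N * ‖pos X i - pos X k‖)
    have h2 := hmB (N * ‖pos X i - pos X k‖)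
    set a := vp (N * ‖pos X i - pos X k‖)
    set c := vm (N * ‖pos X i - pos X k‖)
    -- As `0 ≤ a, c ≤ B`, one has `(a - c)² ≤ a² + c² ≤ B (a + c)`.
    have h3 : (a - c) ^ 2 ≤ B * (a + c) := by nlinarith [mul_nonneg h1.1 h2.1]
    have h4 := mul_le_mul_of_nonneg_left h3 (by positivity : 0 ≤ (N : ℝ) ^ 4 * ‖Ψ X‖ ^ 2)
    refine (le_of_eq ?_).trans (h4.trans (le_of_eq ?_)) <;> ring
  rw [hΨ.integral_pairSum hvp hpB' N hik, hΨ.integral_pairSum hvm hmB' N hik, ← hIp, ← hIm]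
  refine hle.trans ?_
  -- The ratio `N / (N - 1)` is largest at `N = 3`, where it is `3/2`.
  have h5 : (N : ℝ) ^ 2 ≤ 3 / 2 * (N * (N - 1)) := by nlinarith
  have h6 := mul_le_mul_of_nonneg_right h5 (by positivity : 0 ≤ B * (Ip + Im))
  linarith

end Main

theorem mainTheorem4 (V : E3 → ℝ) (hV : IsAdmissible V) (K : ℝ≥0) :
    ∃ C₁ C₂ : ℝ, 0 < C₁ ∧ 0 < C₂ ∧
      ∀ A : E3 → ℝ, MemLp A ∞ volume → eLpNorm A ∞ volume ≤ (K : ℝ≥0∞) →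
      ∀ (N : ℕ) (Ψ : WaveFn N), IsSymm Ψ → MemH2 Ψ → ‖Ψ‖ = 1 →
        (∀ hN : 3 ≤ N,
          pairPotNormSq V (⟨0, by omega⟩ : Fin N) (⟨2, by omega⟩ : Fin N) Ψ
            ≤ C₁ * energyForm V A Ψ + C₂ * N) ∧
        (∀ hN : 1 ≤ N,
          gradNormSq (⟨0, by omega⟩ : Fin N) Ψ
            ≤ C₁ / N * (energyForm V A Ψ + C₂ * N)) := by
  obtain ⟨r₁, r₂, R, lamPlus, h⟩ := hV
  obtain ⟨vp, vm, B, κ, hvp, hvm, hpB, hmB, hp, hm, hκ, hform⟩ := h.exists_form_bound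
  have hpB' : ∀ r, |vp r| ≤ B := fun r => by rw [abs_of_nonneg (hpB r).1]; exact (hpB r).2
  have hmB' : ∀ r, |vm r| ≤ B := fun r => by rw [abs_of_nonneg (hmB r).1]; exact (hmB r).2
  have hB0 : 0 ≤ B := (hpB 0).1.trans (hpB 0).2
  -- This is the share of `P` that survives: `1/2 - (2 + 4κ)/8`.
  set η : ℝ := 1 / 4 - κ / 2 with hη
  have hηpos : 0 < η := by rw [hη]; linarith
  set C₁ : ℝ := 8 / 7 + 3 / 2 * B * (2 / 7 + 2 / η) with hC₁
  have hC₁8 : 8 / 7 ≤ C₁ := by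
    have : 0 ≤ 3 / 2 * B * (2 / 7 + 2 / η) := by positivity
    linarith
  have hK0 : (0 : ℝ) ≤ K := K.2
  -- The term `C₁ K` compensates the external potential, and the added `1` keeps `C₂` positive when
  -- `K = 0`.
  refine ⟨C₁, C₁ * K + 1, by linarith, by nlinarith, fun A hA hAK N Ψ hs hH hn => ?_⟩
  have core : 0 < N → 0 ≤ energyForm V A Ψ + K * N ∧
      ∑ j, gradNormSq j Ψ ≤ 8 / 7 * (energyForm V A Ψ + K * N) ∧
      (∫ X, pairSum vp N X * ‖Ψ X‖ ^ 2) + ∫ X, pairSum vm N X * ‖Ψ X‖ ^ 2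
        ≤ (2 / 7 + 2 / η) * (energyForm V A Ψ + K * N) := by
    intro hN
    obtain ⟨α, hα, hE⟩ := energyForm_eq hvp hvm hpB' hmB' hp hm hA hAK hN hH hn
    have hM := hform N Ψ hN hH
    set T := ∑ j, gradNormSq j Ψ
    set P := ∫ X, pairSum vp N X * ‖Ψ X‖ ^ 2 with hP
    set M := ∫ X, pairSum vm N X * ‖Ψ X‖ ^ 2
    set E := energyForm V A Ψ
    have hT0 : 0 ≤ T := Finset.sum_nonneg fun j _ => Finset.sum_nonneg fun a _ => by positivity
    have hP0 : 0 ≤ P := integral_nonneg fun X => mul_nonneg (Finset.sum_nonneg fun j _ =>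
      Finset.sum_nonneg fun k _ => by
        have := (hpB (N * ‖pos X j - pos X k‖)).1
        split_ifs <;> positivity) (sq_nonneg _)
    have hα' := (abs_le.1 hα).1
    have hmain : 7 / 8 * T + η * P ≤ E + K * N := by
      rw [hη]
      linarith
    have hηP : 0 ≤ η * P := by positivity
    have hT : T ≤ 8 / 7 * (E + K * N) := by linarith
    have hPle : P ≤ 1 / η * (E + K * N) := by
      rw [one_div, le_inv_mul_iff₀ hηpos]
      linarith
    refine ⟨by linarith, hT, ?_⟩
    -- With `κ ≤ 1/2` the form bound becomes `M ≤ T/4 + P`, so `P + M ≤ T/4 + 2 P`; this explains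
    -- `2/7 + 2/η`.
    have h1 : κ * P ≤ 1 / 2 * P := mul_le_mul_of_nonneg_right hκ.le hP0
    have h2 : (2 / 7 + 2 / η) * (E + K * N) = 1 / 4 * (8 / 7 * (E + K * N))
        + 2 * (1 / η * (E + K * N)) := by ring
    rw [h2]
    linarith
  constructor
  · intro hN
    obtain ⟨h0, -, h2⟩ := core (by omega)
    have h3 := pairPotNormSq_le hvp hvm hpB hmB hp hm hs hN
      (i := (⟨0, by omega⟩ : Fin N)) (k := (⟨2, by omega⟩ : Fin N)) (by simp)
    have h4 := mul_le_mul_of_nonneg_left h2 (by positivity : 0 ≤ 3 / 2 * B)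
    have hN0 : (0 : ℝ) ≤ N := Nat.cast_nonneg N
    have h5 : C₁ * energyForm V A Ψ + (C₁ * K + 1) * N
        = 8 / 7 * (energyForm V A Ψ + K * N)
          + 3 / 2 * B * ((2 / 7 + 2 / η) * (energyForm V A Ψ + K * N)) + N := by
      rw [hC₁]; ring
    rw [h5]
    linarith
  · intro hN
    obtain ⟨h0, h1, -⟩ := core (by omega)
    have hNpos : (0 : ℝ) < N := by exact_mod_cast hN
    rw [hs.sum_gradNormSq hH ⟨0, by omega⟩] at h1
    rw [div_mul_eq_mul_div, le_div_iff₀ hNpos, mul_comm]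
    refine h1.trans ?_
    have h2 : energyForm V A Ψ + K * N ≤ energyForm V A Ψ + (C₁ * K + 1) * N := by
      have : (K : ℝ) ≤ C₁ * K + 1 := by nlinarith
      nlinarith
    calc 8 / 7 * (energyForm V A Ψ + K * N) ≤ C₁ * (energyForm V A Ψ + K * N) :=
          mul_le_mul_of_nonneg_right hC₁8 h0
      _ ≤ C₁ * (energyForm V A Ψ + (C₁ * K + 1) * N) :=
          mul_le_mul_of_nonneg_left h2 (by linarith)
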